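/- Call $f\colon D\to\mathbb C$ on a domain $D\subset\mathbb C$ a sense-preserving univalent harmonic mapping if $f$ is harmonic ($f_{z\bar z}=0$) and injective in $D$ and its Jacobian $J_f=|f_z|^2-|f_{\bar z}|^2$ is positive in $D$. Its harmonic pre-Schwarzian derivative is $P_f=(\log J_f)_z$. Let $\mathbb D=\{z:|z|<1\}$, let $\mathcal S_H$ be the class of all sense-preserving univalent harmonic mappings $f=h+\overline g$ in $\mathbb D$, with $h,g$ analytic in $\mathbb D$ and $h(0)=g(0)=0$, $h'(0)=1$, and let $$\alpha_0(\mathcal S_H)=\tfrac12\,\sup\{|h''(0)| : f=h+\overline g\in\mathcal S_H,\ g'(0)=0\}\in[0,\infty].$$ For a simply connected domain $D\subsetneq\mathbb C$, the density $\lambda_D$ of the hyperbolic metric (of curvature $-4$) is determined by $\lambda_D(\varphi(\zeta))\,|\varphi'(\zeta)|=1/(1-|\zeta|^2)$, $\zeta\in\mathbb D$, where $\varphi$ is any conformal map of $\mathbb D$ onto $D$. **Theorem.** Let $D\subsetneq\mathbb C$ be a simply connected domain and let $f$ be a sense-preserving univalent harmonic mapping in $D$. Then $$\lambda_D^{-1}(z)\,|P_f(z)|\le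 2\bigl(\alpha_0(\mathcal S_H)+2\bigr)\qquad\text{for all } z\in D.$$ -/

import Mathlib

open scoped ENNReal Topology ComplexConjugate

/-- The Wirtinger derivative `f_z = (f_x - i f_y) / 2`. -/
noncomputable def wirtingerDz (f : ℂ → ℂ) (z : ℂ) : ℂ :=
  (fderiv ℝ f z 1 - Complex.I * fderiv ℝ f z Complex.I) / 2

/-- The Wirtinger derivative `f_{\bar z} = (f_x + i f_y) / 2`. -/
noncomputable def wirtingerDzBar (f : ℂ → ℂ) (z : ℂ) : ℂ :=
  (fderiv ℝ f z 1 + Complex.I * fderiv ℝ f z Complex.I) / 2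

/-- The Jacobian `J_f = |f_z|² - |f_{\bar z}|²`; for `f = h + conj g` with `h`, `g` holomorphic
this is `|h'|² - |g'|²`. -/
noncomputable def harmonicJacobian (f : ℂ → ℂ) (z : ℂ) : ℝ :=
  ‖wirtingerDz f z‖ ^ 2 - ‖wirtingerDzBar f z‖ ^ 2

/-- `harmonicJacobian f z` is the determinant of the real derivative of `f` at `z`. -/
theorem harmonicJacobian_eq_det (f : ℂ → ℂ) (z : ℂ) :
    harmonicJacobian f z = (fderiv ℝ f z).det := by
  have h : (fderiv ℝ f z).det =
      (LinearMap.toMatrix Complex.basisOneI Complex.basisOneI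
        (fderiv ℝ f z : ℂ →ₗ[ℝ] ℂ)).det := by
    rw [LinearMap.det_toMatrix]
  rw [h, Matrix.det_fin_two]
  simp only [LinearMap.toMatrix_apply, harmonicJacobian, wirtingerDz, wirtingerDzBar,
    Complex.sq_norm, Complex.normSq_apply]
  simp
  ring

/-- The harmonic pre-Schwarzian derivative `P_f = (log J_f)_z`. -/
noncomputable def harmonicPreSchwarzian (f : ℂ → ℂ) (z : ℂ) : ℂ :=
  wirtingerDz (fun w => ((Real.log (harmonicJacobian f w) : ℝ) : ℂ)) z

/-- `f` is a sense-preserving univalent (i.e. injective) harmonic mapping in `D`. -/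
structure IsUnivalentHarmonic (f : ℂ → ℂ) (D : Set ℂ) : Prop where
  harmonic : InnerProductSpace.HarmonicOnNhd f D
  sensePreserving : ∀ z ∈ D, 0 < harmonicJacobian f z
  univalent : Set.InjOn f D

/-- `f = h + conj g` in the unit disk, with `h` and `g` holomorphic there. -/
structure IsDiskDecomposition (f h g : ℂ → ℂ) : Prop where
  holomorphic_left : DifferentiableOn ℂ h (Metric.ball 0 1)
  holomorphic_right : DifferentiableOn ℂ g (Metric.ball 0 1)
  eqOn : ∀ z ∈ Metric.ball (0 : ℂ) 1, f z = h z + conj (g z)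

/-- The class `S_H` of sense-preserving univalent harmonic mappings `f = h + conj g` in the unit
disk with `h(0) = h'(0) - 1 = g(0) = 0`. -/
def classSH : Set (ℂ → ℂ) :=
  {f | IsUnivalentHarmonic f (Metric.ball 0 1) ∧
    ∃ h g : ℂ → ℂ, IsDiskDecomposition f h g ∧ h 0 = 0 ∧ deriv h 0 = 1 ∧ g 0 = 0}

/-- The specified order `α₀(F) = (1/2) sup |h''(0)|` of a family `F` of harmonic mappings in the
unit disk, the supremum being taken in `[0, ∞]` over all `f = h + conj g` in `F` with
`g'(0) = 0`. -/
noncomputable def specifiedOrder (F : Set (ℂ → ℂ)) : ℝ≥0∞ :=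
  (1 / 2) * sSup {r : ℝ≥0∞ | ∃ f ∈ F, ∃ h g : ℂ → ℂ,
    IsDiskDecomposition f h g ∧ deriv g 0 = 0 ∧ r = ‖deriv (deriv h) 0‖ₑ}

/-- `φ` maps the unit disk conformally (holomorphically and bijectively) onto `D`. -/
structure IsConformalOnto (φ : ℂ → ℂ) (D : Set ℂ) : Prop where
  holomorphic : DifferentiableOn ℂ φ (Metric.ball 0 1)
  bijOn : Set.BijOn φ (Metric.ball 0 1) D

theorem IsConformalOnto.inverse_at {φ : ℂ → ℂ} {D : Set ℂ} (h : IsConformalOnto φ D)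
    {ζ : ℂ} (hζ : ζ ∈ Metric.ball (0 : ℂ) 1) :
    deriv φ ζ ≠ 0 ∧
      HasDerivAt (Function.invFunOn φ (Metric.ball 0 1)) (deriv φ ζ)⁻¹ (φ ζ) := by
  set U : Set ℂ := Metric.ball 0 1 with hU
  have hUo : IsOpen U := Metric.isOpen_ball
  set g := Function.invFunOn φ U with hg
  have hgφ : ∀ w ∈ U, g (φ w) = w := fun w hw => h.bijOn.injOn.leftInvOn_invFunOn hw
  have han : ∀ w ∈ U, AnalyticAt ℂ φ w := fun w hw =>
    h.holomorphic.analyticAt (hUo.mem_nhds hw)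
  have hnc : ∀ w ∈ U, ¬ ∀ᶠ z in 𝓝 w, φ z = φ w := by
    intro w hw hc
    have h1 : ∀ᶠ z in 𝓝 w, z = w := by
      filter_upwards [hc, hUo.mem_nhds hw] with z hz hzU
      exact h.bijOn.injOn hzU hw hz
    have h2 : ({w} : Set ℂ) ∈ 𝓝 w := h1
    exact (PerfectSpace.not_isolated w).ne (by
      rw [nhdsWithin, Filter.inf_principal_eq_bot.2]; simpa using h2)
  have hop : ∀ w ∈ U, 𝓝 (φ w) ≤ Filter.map φ (𝓝 w) := fun w hw =>
    ((han w hw).eventually_constant_or_nhds_le_map_nhds).resolve_left (hnc w hw)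
  have hgc : ∀ w ∈ U, ContinuousAt g (φ w) := by
    intro w hw
    rw [ContinuousAt, hgφ w hw]
    refine (Filter.map_mono (hop w hw)).trans ?_
    rw [Filter.map_map]
    refine Filter.Tendsto.congr' (f₁ := id) ?_ Filter.tendsto_id
    filter_upwards [hUo.mem_nhds hw] with z hz
    exact (hgφ z hz).symm
  have hφg : ∀ w ∈ U, ∀ᶠ y in 𝓝 (φ w), φ (g y) = y := by
    intro w hw
    refine hop w hw ?_
    rw [Filter.mem_map]
    filter_upwards [hUo.mem_nhds hw] with z hz
    show φ (g (φ z)) = φ z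
    rw [hgφ z hz]
  have hgd : ∀ w ∈ U, deriv φ w ≠ 0 → HasDerivAt g (deriv φ w)⁻¹ (φ w) := by
    intro w hw hne
    refine HasDerivAt.of_local_left_inverse (f := φ) (hgc w hw) ?_ hne (hφg w hw)
    rw [hgφ w hw]
    exact (han w hw).differentiableAt.hasDerivAt
  have hne : deriv φ ζ ≠ 0 := by
    have hev : ∀ᶠ w in 𝓝[≠] ζ, deriv φ w ≠ 0 := by
      refine ((han ζ hζ).deriv.eventually_eq_zero_or_eventually_ne_zero).resolve_left ?_
      intro h0
      apply hnc ζ hζ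
      obtain ⟨r, hr, hball⟩ := Metric.eventually_nhds_iff_ball.1
        (h0.and (hUo.mem_nhds hζ))
      filter_upwards [Metric.ball_mem_nhds ζ hr] with z hz
      refine (convex_ball ζ r).is_const_of_fderivWithin_eq_zero (𝕜 := ℂ) (f := φ)
        (fun w hw => (han w (hball w hw).2).differentiableAt.differentiableWithinAt) ?_ hz
        (Metric.mem_ball_self hr)
      intro w hw
      rw [fderivWithin_of_isOpen Metric.isOpen_ball hw]
      ext
      simp [(hball w hw).1]
    have hgan : AnalyticAt ℂ g (φ ζ) := by
      refine Complex.analyticAt_of_differentiable_on_punctured_nhds_of_continuousAt ?_ (hgc ζ hζ)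
      rw [eventually_nhdsWithin_iff] at hev ⊢
      refine hop ζ hζ ?_
      rw [Filter.mem_map]
      filter_upwards [hev, hUo.mem_nhds hζ] with w hw hwU
      intro hne
      exact (hgd w hwU (hw (fun e => hne (by rw [Set.mem_singleton_iff.1 e]; rfl)))).differentiableAt
    have hcomp := hgan.differentiableAt.hasDerivAt.comp ζ (han ζ hζ).differentiableAt.hasDerivAt
    have hid : HasDerivAt (g ∘ φ) 1 ζ := by
      refine (hasDerivAt_id ζ).congr_of_eventuallyEq ?_
      filter_upwards [hUo.mem_nhds hζ] with w hw
      exact hgφ w hw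
    intro h0
    rw [h0, mul_zero] at hcomp
    exact zero_ne_one (hcomp.unique hid)
  exact ⟨hne, hgd ζ hζ hne⟩

theorem schwarzPick_deriv {ψ : ℂ → ℂ} (hψ : DifferentiableOn ℂ ψ (Metric.ball 0 1))
    (hm : Set.MapsTo ψ (Metric.ball 0 1) (Metric.ball 0 1)) {a : ℂ}
    (ha : a ∈ Metric.ball (0 : ℂ) 1) :
    ‖deriv ψ a‖ * (1 - ‖a‖ ^ 2) ≤ 1 - ‖ψ a‖ ^ 2 := by
  have key : ∀ b : ℂ, ‖b‖ < 1 → ∀ w : ℂ, ‖w‖ < 1 →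
      1 + conj b * w ≠ 0 ∧ ‖(w + b) / (1 + conj b * w)‖ < 1 := by
    intro b hb w hw
    have hne : 1 + conj b * w ≠ 0 := by
      intro h0
      have h1 : conj b * w = -1 := by linear_combination h0
      have h2 : ‖b‖ * ‖w‖ = 1 := by
        have := congrArg norm h1
        simpa using this
      nlinarith [norm_nonneg b, norm_nonneg w]
    refine ⟨hne, ?_⟩
    rw [norm_div, div_lt_one (norm_pos_iff.2 hne)]
    refine lt_of_pow_lt_pow_left₀ 2 (norm_nonneg _) ?_
    have hb2 : ‖b‖ ^ 2 < 1 := by nlinarith [norm_nonneg b]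
    have hw2 : ‖w‖ ^ 2 < 1 := by nlinarith [norm_nonneg w]
    rw [Complex.sq_norm, Complex.normSq_apply] at *
    rw [Complex.sq_norm, Complex.normSq_apply] at *
    simp only [Complex.add_re, Complex.add_im, Complex.mul_re, Complex.mul_im, Complex.conj_re,
      Complex.conj_im, Complex.one_re, Complex.one_im]
    nlinarith [mul_pos (sub_pos.2 hb2) (sub_pos.2 hw2)]
  have ha' : ‖a‖ < 1 := by simpa using ha
  have hb' : ‖ψ a‖ < 1 := by simpa using hm ha
  set b := ψ a with hb
  have hM : HasDerivAt (fun w : ℂ => (w + a) / (1 + conj a * w)) (1 - conj a * a) 0 := by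
    have h1 : HasDerivAt (fun w : ℂ => w + a) 1 0 := (hasDerivAt_id 0).add_const a
    have h2 : HasDerivAt (fun w : ℂ => 1 + conj a * w) (conj a) 0 := by
      simpa using ((hasDerivAt_id (0 : ℂ)).const_mul (conj a)).const_add 1
    refine (h1.div h2 (by simp)).congr_deriv ?_
    simp [mul_comm]
  have hbb : (1 : ℂ) - conj b * b ≠ 0 := by
    have := (key (-b) (by simpa using hb') b hb').1
    simpa [sub_eq_add_neg] using this
  have hN : HasDerivAt (fun w : ℂ => (w + -b) / (1 + conj (-b) * w)) (1 / (1 - conj b * b)) b := by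
    have h1 : HasDerivAt (fun w : ℂ => w + -b) 1 b := (hasDerivAt_id b).add_const (-b)
    have h2 : HasDerivAt (fun w : ℂ => 1 + conj (-b) * w) (conj (-b)) b := by
      simpa using ((hasDerivAt_id b).const_mul (conj (-b))).const_add 1
    refine (h1.div h2 (key (-b) (by simpa using hb') b hb').1).congr_deriv ?_
    simp only [map_neg, neg_mul, ← sub_eq_add_neg, sub_self]
    field_simp
    simp
  set F : ℂ → ℂ := fun w => (ψ ((w + a) / (1 + conj a * w)) + -b) /
    (1 + conj (-b) * ψ ((w + a) / (1 + conj a * w))) with hF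
  have hMm : ∀ w ∈ Metric.ball (0 : ℂ) 1, (w + a) / (1 + conj a * w) ∈ Metric.ball (0 : ℂ) 1 := by
    intro w hw
    simpa using (key a ha' w (by simpa using hw)).2
  have hFd : DifferentiableOn ℂ F (Metric.ball 0 1) := by
    have hMd : DifferentiableOn ℂ (fun w : ℂ => (w + a) / (1 + conj a * w)) (Metric.ball 0 1) := by
      refine DifferentiableOn.div (by fun_prop) (by fun_prop) ?_
      intro w hw
      exact (key a ha' w (by simpa using hw)).1
    have hc := hψ.comp hMd hMm
    refine DifferentiableOn.div (hc.add_const _) ((hc.const_mul _).const_add _) ?_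
    intro w hw
    exact (key (-b) (by simpa using hb') _ (by simpa using hm (hMm w hw))).1
  have hFm : Set.MapsTo F (Metric.ball 0 1) (Metric.closedBall (F 0) 1) := by
    intro w hw
    have h0 : F 0 = 0 := by simp [hF, hb]
    rw [h0, mem_closedBall_zero_iff]
    exact (key (-b) (by simpa using hb') _ (by simpa using hm (hMm w hw))).2.le
  have hle := Complex.norm_deriv_le_one_of_mapsTo_ball hFd hFm one_pos
  have hψa : HasDerivAt ψ (deriv ψ a) ((0 + a) / (1 + conj a * 0)) := by
    simpa using (hψ.differentiableAt (Metric.isOpen_ball.mem_nhds ha)).hasDerivAt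
  have hc1 := hψa.comp 0 hM
  have hN' : HasDerivAt (fun w : ℂ => (w + -b) / (1 + conj (-b) * w)) (1 / (1 - conj b * b))
      ((ψ ∘ fun w : ℂ => (w + a) / (1 + conj a * w)) 0) := by
    simpa [hb] using hN
  have hFder : HasDerivAt F (1 / (1 - conj b * b) * (deriv ψ a * (1 - conj a * a))) 0 :=
    hN'.comp 0 hc1
  rw [hFder.deriv] at hle
  have hn : ∀ c : ℂ, ‖c‖ < 1 → ‖(1 : ℂ) - conj c * c‖ = 1 - ‖c‖ ^ 2 := by
    intro c hc
    have : (1 : ℂ) - conj c * c = ((1 - ‖c‖ ^ 2 : ℝ) : ℂ) := by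
      rw [mul_comm, Complex.mul_conj, Complex.normSq_eq_norm_sq]; push_cast; rfl
    rw [this, Complex.norm_real, Real.norm_of_nonneg]
    nlinarith [norm_nonneg c]
  have hpos : 0 < 1 - ‖b‖ ^ 2 := by nlinarith [norm_nonneg b]
  rw [norm_mul, norm_div, norm_mul, norm_one, hn a ha', hn b hb', one_div, inv_mul_eq_div,
    div_le_one hpos] at hle
  exact hle

theorem IsConformalOnto.le_of_eq {φ₁ φ₂ : ℂ → ℂ} {D : Set ℂ} (h₁ : IsConformalOnto φ₁ D)
    (h₂ : IsConformalOnto φ₂ D) {ζ₁ ζ₂ : ℂ} (hζ₁ : ζ₁ ∈ Metric.ball (0 : ℂ) 1)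
    (hζ₂ : ζ₂ ∈ Metric.ball (0 : ℂ) 1) (he : φ₁ ζ₁ = φ₂ ζ₂) :
    (1 - ‖ζ₁‖ ^ 2) * ‖deriv φ₁ ζ₁‖ ≤ (1 - ‖ζ₂‖ ^ 2) * ‖deriv φ₂ ζ₂‖ := by
  set U : Set ℂ := Metric.ball 0 1 with hU
  have hUo : IsOpen U := Metric.isOpen_ball
  set g := Function.invFunOn φ₂ U with hg
  have hmem : ∀ w ∈ U, ∃ v ∈ U, φ₂ v = φ₁ w := fun w hw =>
    h₂.bijOn.surjOn (h₁.bijOn.mapsTo hw)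
  have hgm : ∀ w ∈ U, g (φ₁ w) ∈ U := fun w hw => Function.invFunOn_mem (hmem w hw)
  have hder : ∀ w ∈ U, ∀ v ∈ U, φ₂ v = φ₁ w →
      HasDerivAt (g ∘ φ₁) ((deriv φ₂ v)⁻¹ * deriv φ₁ w) w := by
    intro w hw v hv hvw
    have h3 := (h₂.inverse_at hv).2
    rw [hvw] at h3
    exact h3.comp w (h₁.holomorphic.differentiableAt (hUo.mem_nhds hw)).hasDerivAt
  have hd : DifferentiableOn ℂ (g ∘ φ₁) U := by
    intro w hw
    obtain ⟨v, hv, hvw⟩ := hmem w hw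
    exact (hder w hw v hv hvw).differentiableAt.differentiableWithinAt
  have hsp := schwarzPick_deriv hd hgm hζ₁
  have hval : (g ∘ φ₁) ζ₁ = ζ₂ := by
    show g (φ₁ ζ₁) = ζ₂
    rw [he]; exact h₂.bijOn.injOn.leftInvOn_invFunOn hζ₂
  have hpos : 0 < ‖deriv φ₂ ζ₂‖ := norm_pos_iff.2 (h₂.inverse_at hζ₂).1
  rw [hval, (hder ζ₁ hζ₁ ζ₂ hζ₂ he.symm).deriv, norm_mul, norm_inv, inv_mul_eq_div, div_mul_eq_mul_div,
    div_le_iff₀ hpos] at hsp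
  linarith

open Classical in
/-- The density `λ_D` of the hyperbolic metric (of curvature `-4`) of a simply connected domain
`D ≠ ℂ`: `λ_D(φ(ζ)) |φ'(ζ)| = 1 / (1 - |ζ|²)` for a conformal map `φ` of the unit disk onto `D`.
Such a `φ` exists by the Riemann mapping theorem, and the value does not depend on its choice, see
`hyperbolicDensity_mul_norm_deriv`. (Outside this setting the value is the default `0`.) -/
noncomputable def hyperbolicDensity (D : Set ℂ) (z : ℂ) : ℝ :=
  if H : ∃ p : (ℂ → ℂ) × ℂ, IsConformalOnto p.1 D ∧ p.2 ∈ Metric.ball (0 : ℂ) 1 ∧ p.1 p.2 = z then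
    1 / ((1 - ‖H.choose.2‖ ^ 2) * ‖deriv H.choose.1 H.choose.2‖)
  else 0

/-- The defining relation `λ_D(φ(ζ)) |φ'(ζ)| = λ_𝔻(ζ) = 1 / (1 - |ζ|²)` holds for every conformal
map `φ` of the unit disk onto `D`. -/
theorem hyperbolicDensity_mul_norm_deriv {φ : ℂ → ℂ} {D : Set ℂ} (h : IsConformalOnto φ D)
    {ζ : ℂ} (hζ : ζ ∈ Metric.ball (0 : ℂ) 1) :
    hyperbolicDensity D (φ ζ) * ‖deriv φ ζ‖ = 1 / (1 - ‖ζ‖ ^ 2) := by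
  have H : ∃ p : (ℂ → ℂ) × ℂ, IsConformalOnto p.1 D ∧ p.2 ∈ Metric.ball (0 : ℂ) 1 ∧
      p.1 p.2 = φ ζ := ⟨(φ, ζ), h, hζ, rfl⟩
  obtain ⟨hc, hm, he⟩ := H.choose_spec
  have hq := le_antisymm (hc.le_of_eq h hm hζ he) (h.le_of_eq hc hζ hm he.symm)
  have hpos : 0 < ‖deriv φ ζ‖ := norm_pos_iff.2 (h.inverse_at hζ).1
  have h1 : 0 < 1 - ‖ζ‖ ^ 2 := by
    have : ‖ζ‖ < 1 := by simpa using hζ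
    nlinarith [norm_nonneg ζ]
  rw [hyperbolicDensity, dif_pos H, hq]
  field_simp

/-! Take a Riemann map `φ` of the unit disk onto `D` with `φ 0 = z` and put `F = f ∘ φ`. Since `J_F
= (J_f ∘ φ) |φ'|²`, taking logarithms and differentiating gives `P_F(0) = P_f(z) φ'(0) + φ''(0) /
φ'(0)`, while `λ_D(z)⁻¹ = |φ'(0)|`. Hence `λ_D(z)⁻¹ |P_f(z)| ≤ |P_F(0)| + |φ''(0) / φ'(0)|`, and the
two terms are bounded separately.

The second term is at most 4 by Bieberbach's coefficient theorem (`norm_deriv_deriv_le_four_mul`),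
which follows from Gronwall's area theorem (`norm_le_one_of_injOn_inv_add`) applied to the
reciprocal of the odd square-root transform.

The first term is at most `2 α₀` (`norm_div_harmonicJacobian_le_specifiedOrder`). Composing `F` with
an invertible real affine map multiplies `J_F` by a constant and so leaves `P_F` unchanged. A
suitable such map turns `F` into a member `h + conj g` of `S_H` with `g'(0) = 0`, for which `P(0) =
h''(0)`.

The existence of `φ` (`exists_isConformalOnto`) is Koebe's extremal argument: maximize `|g'(z₀)|`
over univalent maps into the disk, with Montel and Hurwitz supplying the extremal map and the square
root trick its surjectivity. -/

/-! ### Univalent functions and their limits: Montel and Hurwitz. -/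

theorem deriv_ne_zero_of_injOn {g : ℂ → ℂ} {U : Set ℂ} (hU : IsOpen U)
    (hg : DifferentiableOn ℂ g U) (hinj : Set.InjOn g U) {z : ℂ} (hz : z ∈ U) :
    deriv g z ≠ 0 := by
  obtain ⟨r, hr, hball⟩ := Metric.isOpen_iff.1 hU z hz
  have hmaps : Set.MapsTo (fun ζ : ℂ => z + r * ζ) (Metric.ball 0 1) U := by
    intro ζ hζ
    apply hball
    have : ‖ζ‖ < 1 := by simpa using hζ
    simp only [Metric.mem_ball, dist_self_add_left, norm_mul, Complex.norm_real,
      Real.norm_of_nonneg hr.le]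
    nlinarith
  have hc : IsConformalOnto (fun ζ => g (z + r * ζ)) ((fun ζ => g (z + r * ζ)) '' Metric.ball 0 1) := by
    refine ⟨hg.comp (by fun_prop) hmaps, ?_⟩
    refine Set.InjOn.bijOn_image ?_
    intro a ha b hb hab
    have := hinj (hmaps ha) (hmaps hb) hab
    simpa [hr.ne'] using this
  have h0 := (hc.inverse_at (Metric.mem_ball_self one_pos)).1
  have hd : HasDerivAt (fun ζ : ℂ => g (z + r * ζ)) (deriv g z * r) 0 := by
    have h1 : HasDerivAt g (deriv g z) (z + r * 0) := by
      simpa using (hg.differentiableAt (hU.mem_nhds hz)).hasDerivAt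
    have h2 : HasDerivAt (fun ζ : ℂ => z + r * ζ) (r : ℂ) 0 := by
      simpa using ((hasDerivAt_id (0 : ℂ)).const_mul (r : ℂ)).const_add z
    exact h1.comp 0 h2
  intro h
  rw [hd.deriv, h, zero_mul] at h0
  exact h0 rfl

/-- Along an ultrafilter, a uniformly bounded family of holomorphic functions converges locally
uniformly (Montel's theorem). -/
theorem exists_tendstoLocallyUniformlyOn_of_mapsTo_ball {ι : Type*} (l : Ultrafilter ι)
    {U : Set ℂ} (hU : IsOpen U) {F : ι → ℂ → ℂ} (hF : ∀ i, DifferentiableOn ℂ (F i) U)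
    (hb : ∀ i, Set.MapsTo (F i) U (Metric.ball 0 1)) :
    ∃ g : ℂ → ℂ, TendstoLocallyUniformlyOn F g l U := by
  -- An ultrafilter on a compact disk converges, so pointwise limits exist without extracting
  -- subsequences. Outside `U` the value is irrelevant.
  have hlim : ∀ z, ∃ w, z ∈ U → Filter.Tendsto (fun i => F i z) l (𝓝 w) := by
    intro z
    by_cases hz : z ∈ U
    · obtain ⟨w, -, hw⟩ := (isCompact_closedBall (0 : ℂ) 1).ultrafilter_le_nhds
        (l.map (fun i => F i z)) (by
          rw [Filter.le_principal_iff]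
          exact Ultrafilter.mem_map.2
            (Filter.univ_mem' fun i => Metric.ball_subset_closedBall (hb i hz)))
      exact ⟨w, fun _ => hw⟩
    · exact ⟨0, fun h => absurd h hz⟩
  choose g hg using hlim
  refine ⟨g, Metric.tendstoLocallyUniformlyOn_iff.2 ?_⟩
  intro ε hε x hx
  obtain ⟨r, hr, hball⟩ := Metric.isOpen_iff.1 hU x hx
  -- The Schwarz lemma gives a Lipschitz bound at `x` independent of `i`; this equicontinuity
  -- upgrades pointwise to locally uniform convergence.
  have hlip : ∀ i, ∀ y ∈ Metric.ball x r, dist (F i y) (F i x) ≤ 2 / r * dist y x := by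
    intro i y hy
    refine Complex.dist_le_div_mul_dist_of_mapsTo_ball ((hF i).mono hball) ?_ hy
    intro w hw
    have h1 := hb i (hball hw)
    have h2 := hb i hx
    rw [mem_ball_zero_iff] at h1 h2
    rw [Metric.mem_closedBall, dist_eq_norm]
    linarith [norm_sub_le (F i w) (F i x)]
  have hlip' : ∀ y ∈ Metric.ball x r, dist (g y) (g x) ≤ 2 / r * dist y x := by
    intro y hy
    exact le_of_tendsto ((hg y (hball hy)).dist (hg x hx))
      (Filter.Eventually.of_forall fun i => hlip i y hy)
  refine ⟨Metric.ball x (min r (ε * r / 8)),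
    mem_nhdsWithin_of_mem_nhds (Metric.ball_mem_nhds _ (by positivity)), ?_⟩
  filter_upwards [Metric.tendsto_nhds.1 (hg x hx) (ε / 4) (by positivity)] with i hi y hy
  have hy' : dist y x < ε * r / 8 := (Metric.mem_ball.1 hy).trans_le (min_le_right _ _)
  have hyr : y ∈ Metric.ball x r := Metric.ball_subset_ball (min_le_left _ _) hy
  have hk : 2 / r * dist y x ≤ ε / 4 := by
    rw [div_mul_eq_mul_div, div_le_iff₀ hr]; linarith
  have h1 := hlip i y hyr
  have h2 := hlip' y hyr
  have h3 := dist_triangle4 (g y) (g x) (F i x) (F i y)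
  rw [dist_comm (g x), dist_comm (F i x) (F i y)] at h3
  linarith

/-- A nonconstant locally uniform limit of injective holomorphic functions is injective
(Hurwitz's theorem). -/
theorem injOn_of_tendstoLocallyUniformlyOn {ι : Type*} {l : Filter ι} [l.NeBot]
    {U : Set ℂ} (hU : IsOpen U) (hUc : IsPreconnected U) {F : ι → ℂ → ℂ} {g : ℂ → ℂ}
    (hF : ∀ i, DifferentiableOn ℂ (F i) U) (hinj : ∀ i, Set.InjOn (F i) U)
    (hlim : TendstoLocallyUniformlyOn F g l U) {z₀ : ℂ} (hz₀ : z₀ ∈ U) (hne : deriv g z₀ ≠ 0) :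
    Set.InjOn g U := by
  have hgd : DifferentiableOn ℂ g U := hlim.differentiableOn (Filter.Eventually.of_forall hF) hU
  have hga : AnalyticOnNhd ℂ g U := hgd.analyticOnNhd hU
  intro a ha b hb hab
  by_contra hne_ab
  have hiso : ∀ᶠ z in 𝓝[≠] a, g z ≠ g a := by
    have := (hga a ha).eventually_eq_or_eventually_ne (analyticAt_const (v := g a))
    refine this.resolve_left fun h => hne ?_
    have heq : Set.EqOn g (fun _ => g a) U :=
      hga.eqOn_of_preconnected_of_eventuallyEq analyticOnNhd_const hUc ha h
    have : g =ᶠ[𝓝 z₀] fun _ => g a := Filter.eventually_of_mem (hU.mem_nhds hz₀) heq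
    rw [this.deriv_eq, deriv_const]
  rw [eventually_nhdsWithin_iff] at hiso
  -- The disk is small enough that `a` is the only point of its fibre there and that `b` lies
  -- outside.
  obtain ⟨r, hr, hball⟩ := Metric.eventually_nhds_iff_ball.1
    (hiso.and ((hU.eventually_mem ha).and (isOpen_ne.eventually_mem hne_ab)))
  set s := r / 2 with hs
  have hs0 : 0 < s := by positivity
  have hcb : Metric.closedBall a s ⊆ Metric.ball a r :=
    Metric.closedBall_subset_ball (by linarith)
  have hsph : (Metric.sphere a s).Nonempty := NormedSpace.sphere_nonempty.2 hs0.le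
  have hcbU : Metric.closedBall a s ⊆ U := fun z hz => (hball z (hcb hz)).2.1
  obtain ⟨m, hm, hmin⟩ := (isCompact_sphere a s).exists_isMinOn hsph
    (f := fun z => ‖g z - g a‖) (((hgd.continuousOn.mono
      (Metric.sphere_subset_closedBall.trans hcbU)).sub continuousOn_const).norm)
  set δ := ‖g m - g a‖ with hδ
  have hδ0 : 0 < δ := by
    rw [hδ, norm_pos_iff, sub_ne_zero]
    refine (hball m (hcb (Metric.sphere_subset_closedBall hm))).1 ?_
    intro h
    rw [Set.mem_singleton_iff] at h
    rw [h, Metric.mem_sphere, dist_self] at hm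
    exact hs0.ne hm
  have hunif : TendstoUniformlyOn F g l (Metric.closedBall a s) :=
    (tendstoLocallyUniformlyOn_iff_tendstoUniformlyOn_of_compact
      (isCompact_closedBall a s)).1 (hlim.mono hcbU)
  have e1 := Metric.tendstoUniformlyOn_iff.1 hunif (δ / 16) (by positivity)
  have e2 := Metric.tendsto_nhds.1 (hlim.tendsto_at hb) (δ / 16) (by positivity)
  obtain ⟨i, h1, h2⟩ := (e1.and e2).exists
  -- Quantitative open mapping: on the circle `F i` stays at least `δ - 2δ/16 ≥ δ/2` away from `F i
  -- a`, so the disk's image covers radius `δ/4` about `F i a`. That includes `F i b`, which is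
  -- within `δ/8`, against injectivity.
  have hsub : Metric.ball (F i a) (δ / 2 / 2) ⊆ F i '' Metric.closedBall a s := by
    refine DiffContOnCl.ball_subset_image_closedBall ?_ hs0 ?_ ?_
    · exact ((hF i).mono (by rw [closure_ball a hs0.ne']; exact hcbU)).diffContOnCl
    · intro z hz
      have h3 := h1 z (Metric.sphere_subset_closedBall hz)
      have h4 := h1 a (Metric.mem_closedBall_self hs0.le)
      have h5 : δ ≤ ‖g z - g a‖ := hmin hz
      rw [← dist_eq_norm] at h5 ⊢
      have := dist_triangle4 (g z) (F i z) (F i a) (g a)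
      rw [dist_comm (F i a) (g a)] at this
      linarith
    · refine Filter.Eventually.frequently (f := 𝓝[≠] a) ?_ |>.filter_mono nhdsWithin_le_nhds
      rw [eventually_nhdsWithin_iff]
      filter_upwards [hU.mem_nhds ha] with z hz hza h
      exact hza (hinj i hz ha h)
  obtain ⟨w, hw, hwb⟩ := hsub (show F i b ∈ _ by
    have h4 := h1 a (Metric.mem_closedBall_self hs0.le)
    rw [Metric.mem_ball]
    have := dist_triangle (F i b) (g b) (F i a)
    rw [← hab] at this h2
    linarith)
  have hw' := hball w (hcb hw)
  exact hw'.2.2 (hinj i hw'.2.1 hb hwb)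

/-! ### Disk automorphisms, the square root trick and the Riemann mapping theorem. -/

/-- The disk automorphism `w ↦ (w + a) / (1 + conj a * w)`. -/
noncomputable def diskAutomorphism (a w : ℂ) : ℂ := (w + a) / (1 + conj a * w)

namespace diskAutomorphism

variable {a w : ℂ}

theorem denom_ne_zero (ha : ‖a‖ < 1) (hw : ‖w‖ < 1) : 1 + conj a * w ≠ 0 := by
  intro h0
  have h1 : conj a * w = -1 := by linear_combination h0
  have h2 : ‖a‖ * ‖w‖ = 1 := by simpa using congrArg norm h1
  nlinarith [norm_nonneg a, norm_nonneg w]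

theorem norm_lt_one (ha : ‖a‖ < 1) (hw : ‖w‖ < 1) : ‖diskAutomorphism a w‖ < 1 := by
  rw [diskAutomorphism, norm_div, div_lt_one (norm_pos_iff.2 (denom_ne_zero ha hw))]
  refine lt_of_pow_lt_pow_left₀ 2 (norm_nonneg _) ?_
  have hb2 : ‖a‖ ^ 2 < 1 := by nlinarith [norm_nonneg a]
  have hw2 : ‖w‖ ^ 2 < 1 := by nlinarith [norm_nonneg w]
  rw [Complex.sq_norm, Complex.normSq_apply] at *
  rw [Complex.sq_norm, Complex.normSq_apply] at *
  simp only [Complex.add_re, Complex.add_im, Complex.mul_re, Complex.mul_im, Complex.conj_re,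
    Complex.conj_im, Complex.one_re, Complex.one_im]
  nlinarith [mul_pos (sub_pos.2 hb2) (sub_pos.2 hw2)]

theorem one_sub_conj_mul_self_ne_zero (ha : ‖a‖ < 1) : 1 - conj a * a ≠ 0 := by
  have := denom_ne_zero (a := -a) (by simpa using ha) ha
  simpa [sub_eq_add_neg] using this

theorem neg_apply_apply (ha : ‖a‖ < 1) (hw : ‖w‖ < 1) :
    diskAutomorphism (-a) (diskAutomorphism a w) = w := by
  have h1 := denom_ne_zero ha hw
  have h3 := one_sub_conj_mul_self_ne_zero ha
  have h2 : 1 + conj (-a) * ((w + a) / (1 + conj a * w)) ≠ 0 :=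
    denom_ne_zero (by simpa using ha) (norm_lt_one ha hw)
  rw [diskAutomorphism, diskAutomorphism, div_eq_iff h2, map_neg,
    ← mul_left_inj' h1, add_mul, mul_assoc w, add_mul, div_mul_cancel₀ _ h1, neg_mul, neg_mul,
    neg_mul, mul_assoc (conj a), div_mul_cancel₀ _ h1]
  ring

theorem injOn (ha : ‖a‖ < 1) : Set.InjOn (diskAutomorphism a) (Metric.ball 0 1) := by
  intro x hx y hy h
  rw [mem_ball_zero_iff] at hx hy
  rw [← neg_apply_apply ha hx, h, neg_apply_apply ha hy]

theorem hasDerivAt (ha : ‖a‖ < 1) (hw : ‖w‖ < 1) :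
    HasDerivAt (diskAutomorphism a) ((1 - conj a * a) / (1 + conj a * w) ^ 2) w := by
  have h1 : HasDerivAt (fun w : ℂ => w + a) 1 w := (hasDerivAt_id w).add_const a
  have h2 : HasDerivAt (fun w : ℂ => 1 + conj a * w) (conj a) w := by
    simpa using ((hasDerivAt_id w).const_mul (conj a)).const_add 1
  refine (h1.div h2 (denom_ne_zero ha hw)).congr_deriv ?_
  ring

theorem norm_one_sub_conj_mul_self (ha : ‖a‖ < 1) : ‖1 - conj a * a‖ = 1 - ‖a‖ ^ 2 := by
  have : (1 : ℂ) - conj a * a = ((1 - ‖a‖ ^ 2 : ℝ) : ℂ) := by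
    rw [mul_comm, Complex.mul_conj, Complex.normSq_eq_norm_sq]; push_cast; rfl
  rw [this, Complex.norm_real, Real.norm_of_nonneg]
  nlinarith [norm_nonneg a]

theorem differentiableOn_comp {f : ℂ → ℂ} {U : Set ℂ} (ha : ‖a‖ < 1)
    (hf : DifferentiableOn ℂ f U) (hm : Set.MapsTo f U (Metric.ball 0 1)) :
    DifferentiableOn ℂ (fun z => diskAutomorphism a (f z)) U := by
  intro z hz
  have h := (hasDerivAt ha (mem_ball_zero_iff.1 (hm hz))).differentiableAt
  exact h.comp_differentiableWithinAt z (hf z hz)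

theorem mapsTo_comp {f : ℂ → ℂ} {U : Set ℂ} (ha : ‖a‖ < 1)
    (hm : Set.MapsTo f U (Metric.ball 0 1)) :
    Set.MapsTo (fun z => diskAutomorphism a (f z)) U (Metric.ball 0 1) :=
  fun _ hz => mem_ball_zero_iff.2 (norm_lt_one ha (mem_ball_zero_iff.1 (hm hz)))

end diskAutomorphism

/-- A nowhere zero holomorphic function on a simply connected open set has a holomorphic
square root. -/
theorem exists_holomorphic_sqrt {U : Set ℂ} (hU : IsOpen U) (hUc : IsSimplyConnected U)
    {q : ℂ → ℂ} (hq : DifferentiableOn ℂ q U) (h0 : ∀ z ∈ U, q z ≠ 0) :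
    ∃ s : ℂ → ℂ, DifferentiableOn ℂ s U ∧ ∀ z, s z ^ 2 = q z := by
  obtain ⟨s, hsc, hs⟩ := Complex.exists_continuousOn_pow_eq hUc hU hq.continuousOn
    (by rintro ⟨z, hz, h⟩; exact h0 z hz h) two_ne_zero
  refine ⟨s, fun z hz => ?_, hs⟩
  have hsz : s z ≠ 0 := fun h => h0 z hz (by rw [← hs, h]; simp)
  have hcont : ContinuousAt s z := hsc.continuousAt (hU.mem_nhds hz)
  have hsum : Filter.Tendsto (fun w => s w + s z) (𝓝 z) (𝓝 (s z + s z)) := hcont.add_const _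
  have hne : s z + s z ≠ 0 := by rw [← two_mul]; exact mul_ne_zero two_ne_zero hsz
  have hslope := hasDerivAt_iff_tendsto_slope.1
    (hq.differentiableAt (hU.mem_nhds hz)).hasDerivAt
  -- The slope of `s` is the slope of `q = s²` divided by `s w + s z`, which has the nonzero limit
  -- `2 s z`.
  have hds : HasDerivAt s (deriv q z * (s z + s z)⁻¹) z := by
    rw [hasDerivAt_iff_tendsto_slope]
    refine (hslope.mul ((hsum.inv₀ hne).mono_left nhdsWithin_le_nhds)).congr' ?_
    have := hsum.eventually_ne hne
    filter_upwards [this.filter_mono nhdsWithin_le_nhds] with w hw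
    rw [slope_def_field, slope_def_field, ← hs, ← hs]
    have : s w ^ 2 - s z ^ 2 = (s w - s z) * (s w + s z) := by ring
    rw [this, div_mul_eq_mul_div, mul_assoc, mul_inv_cancel₀ hw, mul_one]
  exact hds.differentiableAt.differentiableWithinAt

/-- The Koebe square root trick: an injective holomorphic map into the disk which misses a point
can be replaced by one with a larger derivative at the base point. -/
theorem exists_norm_deriv_lt_of_notMem_image {U : Set ℂ} (hU : IsOpen U)
    (hUc : IsSimplyConnected U) {z₀ : ℂ} (hz₀ : z₀ ∈ U) {g : ℂ → ℂ}
    (hg : DifferentiableOn ℂ g U) (hm : Set.MapsTo g U (Metric.ball 0 1)) (hinj : Set.InjOn g U)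
    (hg0 : g z₀ = 0) {w₀ : ℂ} (hw₀ : ‖w₀‖ < 1) (hmiss : w₀ ∉ g '' U) :
    ∃ k : ℂ → ℂ, DifferentiableOn ℂ k U ∧ Set.MapsTo k U (Metric.ball 0 1) ∧ Set.InjOn k U ∧
      k z₀ = 0 ∧ ‖deriv g z₀‖ < ‖deriv k z₀‖ := by
  have hw₀' : ‖-w₀‖ < 1 := by simpa using hw₀
  have hqd := diskAutomorphism.differentiableOn_comp hw₀' hg hm
  have hqm := diskAutomorphism.mapsTo_comp hw₀' hm
  -- The automorphism moving `w₀` to `0`, composed with `g`, has no zero because `g` misses `w₀`.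
  obtain ⟨s, hsd, hs⟩ := exists_holomorphic_sqrt hU hUc hqd (by
    intro z hz h
    rw [diskAutomorphism, div_eq_zero_iff] at h
    rcases h with h | h
    · exact hmiss ⟨z, hz, by linear_combination h⟩
    · exact diskAutomorphism.denom_ne_zero hw₀' (mem_ball_zero_iff.1 (hm hz)) h)
  have hsm : Set.MapsTo s U (Metric.ball 0 1) := by
    intro z hz
    have h1 := hqm hz
    simp only [← hs, mem_ball_zero_iff, norm_pow] at h1
    rw [mem_ball_zero_iff]
    by_contra! h
    nlinarith
  have hsinj : Set.InjOn s U := by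
    intro x hx y hy hxy
    refine hinj hx hy (diskAutomorphism.injOn hw₀' (hm hx) (hm hy) ?_)
    rw [← hs, ← hs, hxy]
  set a := s z₀ with ha
  have ha1 : ‖a‖ < 1 := mem_ball_zero_iff.1 (hsm hz₀)
  have ha1' : ‖-a‖ < 1 := by simpa using ha1
  have ha2 : a ^ 2 = -w₀ := by
    rw [ha, hs, hg0]; simp [diskAutomorphism]
  have hw0 : w₀ ≠ 0 := by
    rintro rfl
    exact hmiss ⟨z₀, hz₀, hg0⟩
  have ha0 : 0 < ‖a‖ := by
    rw [norm_pos_iff]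
    rintro h
    rw [h] at ha2
    exact hw0 (by simpa using ha2)
  have hgz := (hg.differentiableAt (hU.mem_nhds hz₀)).hasDerivAt
  have hsz := (hsd.differentiableAt (hU.mem_nhds hz₀)).hasDerivAt
  have hg' : 0 < ‖deriv g z₀‖ := norm_pos_iff.2 (deriv_ne_zero_of_injOn hU hg hinj hz₀)
  have hD : HasDerivAt (diskAutomorphism (-w₀)) (1 - conj w₀ * w₀) (g z₀) := by
    rw [hg0]
    simpa using diskAutomorphism.hasDerivAt (w := 0) hw₀' (by simp)
  have hrel : 2 * a * deriv s z₀ = (1 - conj w₀ * w₀) * deriv g z₀ := by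
    have h1 := hD.comp z₀ hgz
    have h2 : HasDerivAt (diskAutomorphism (-w₀) ∘ g) (2 * a * deriv s z₀) z₀ := by
      have h3 : HasDerivAt (fun z => s z ^ 2) (2 * a * deriv s z₀) z₀ := by
        simpa using hsz.fun_pow 2
      have h4 : (fun z => s z ^ 2) = diskAutomorphism (-w₀) ∘ g := funext hs
      rwa [h4] at h3
    exact h2.unique h1
  have hk' : HasDerivAt (fun z => diskAutomorphism (-a) (s z))
      ((1 - conj a * a)⁻¹ * deriv s z₀) z₀ := by
    have h1 := diskAutomorphism.hasDerivAt ha1' ha1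
    have h2 := h1.comp z₀ hsz
    refine h2.congr_deriv ?_
    have := diskAutomorphism.one_sub_conj_mul_self_ne_zero ha1
    simp only [map_neg, neg_mul, mul_neg, neg_neg, ← sub_eq_add_neg]
    field_simp
  refine ⟨fun z => diskAutomorphism (-a) (s z),
    diskAutomorphism.differentiableOn_comp ha1' hsd hsm,
    diskAutomorphism.mapsTo_comp ha1' hsm, ?_, ?_, ?_⟩
  · intro x hx y hy hxy
    exact hsinj hx hy (diskAutomorphism.injOn ha1' (hsm hx) (hsm hy) hxy)
  · simp [diskAutomorphism, ← ha]
  · rw [hk'.deriv, norm_mul, norm_inv, diskAutomorphism.norm_one_sub_conj_mul_self ha1]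
    have h1 := congrArg norm hrel
    have h2 : ‖w₀‖ = ‖a‖ ^ 2 := by rw [← norm_pow, ha2, norm_neg]
    rw [norm_mul, norm_mul, norm_mul, diskAutomorphism.norm_one_sub_conj_mul_self hw₀, h2] at h1
    simp only [Complex.norm_ofNat] at h1
    have hpos : 0 < 1 - ‖a‖ ^ 2 := by nlinarith
    rw [inv_mul_eq_div, lt_div_iff₀ hpos]
    -- The gain factor is `(1 + |a|²) / (2|a|)`, since `|w₀| = |a|²`; it exceeds 1 because `(1 -
    -- |a|)² > 0`.
    have h3 : ‖deriv g z₀‖ * (2 * ‖a‖) < (1 + ‖a‖ ^ 2) * ‖deriv g z₀‖ := by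
      nlinarith [mul_pos hg' (pow_pos (sub_pos.2 ha1) 2)]
    have h4 : 2 * ‖a‖ * ‖deriv s z₀‖ = (1 - ‖a‖ ^ 2) * ((1 + ‖a‖ ^ 2) * ‖deriv g z₀‖) := by
      rw [h1]; ring
    nlinarith [mul_lt_mul_of_pos_left h3 hpos]

/-- A simply connected open set other than `ℂ` embeds holomorphically into the unit disk. -/
theorem exists_injOn_mapsTo_unitBall {U : Set ℂ} (hU : IsOpen U) (hUc : IsSimplyConnected U)
    (hne : U ≠ Set.univ) :
    ∃ f : ℂ → ℂ, DifferentiableOn ℂ f U ∧ Set.MapsTo f U (Metric.ball 0 1) ∧ Set.InjOn f U := by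
  obtain ⟨a, ha⟩ := (Set.ne_univ_iff_exists_notMem U).1 hne
  obtain ⟨s, hsd, hs⟩ := exists_holomorphic_sqrt hU hUc (q := fun z => z - a) (by fun_prop)
    (fun z hz h => ha (by rwa [← sub_eq_zero.1 h]))
  have hs_inj : ∀ z w, s z ^ 2 = s w ^ 2 → z = w := by
    intro z w h
    rw [hs, hs] at h
    linear_combination h
  have hsi : Set.InjOn s U := fun z _ w _ h => hs_inj z w (by rw [h])
  obtain ⟨z₁, hz₁⟩ := hUc.nonempty
  have hstrict : HasStrictDerivAt s (deriv s z₁) z₁ :=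
    (hsd.analyticAt (hU.mem_nhds hz₁)).hasStrictDerivAt
  have hnhds : s '' U ∈ 𝓝 (s z₁) := by
    rw [← hstrict.map_nhds_eq (deriv_ne_zero_of_injOn hU hsd hsi hz₁)]
    exact Filter.image_mem_map (hU.mem_nhds hz₁)
  obtain ⟨ε, hε, hball⟩ := Metric.mem_nhds_iff.1 hnhds
  -- The root `s` never takes both a value and its negative: equal squares force equal points, hence
  -- the value `0`, which would put `a` in `U`. So the disk about `s z₁` covered by `s` has a
  -- reflection that `s` avoids.
  have hfar : ∀ z ∈ U, ε ≤ ‖s z + s z₁‖ := by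
    intro z hz
    by_contra! h
    obtain ⟨w, hw, hwz⟩ := hball (show -s z ∈ Metric.ball (s z₁) ε by
      rw [Metric.mem_ball, dist_eq_norm, ← norm_neg]
      simpa [add_comm] using h)
    have hzw : w = z := hs_inj w z (by rw [hwz]; ring)
    rw [hzw] at hwz
    have h0 : s z = 0 := by linear_combination hwz / 2
    have := hs z
    rw [h0] at this
    exact ha (by rwa [show a = z by linear_combination this])
  have hne0 : ∀ z ∈ U, s z + s z₁ ≠ 0 := fun z hz =>
    norm_pos_iff.1 (hε.trans_le (hfar z hz))
  refine ⟨fun z => (ε / 2 : ℝ) / (s z + s z₁), (differentiableOn_const _).div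
    (hsd.add_const _) hne0, ?_, ?_⟩
  · intro z hz
    rw [mem_ball_zero_iff, norm_div, Complex.norm_real, Real.norm_of_nonneg (by positivity),
      div_lt_one (hε.trans_le (hfar z hz))]
    linarith [hfar z hz]
  · intro z hz w hw h
    have hε' : ((ε / 2 : ℝ) : ℂ) ≠ 0 := by exact_mod_cast (half_pos hε).ne'
    simp only [div_eq_mul_inv] at h
    have h1 := inv_injective (mul_left_cancel₀ (by simpa using hε') h)
    exact hsi hz hw (add_right_cancel h1)

/-- The Riemann mapping theorem. -/
theorem exists_isConformalOnto {D : Set ℂ} (hD : IsOpen D) (hDc : IsSimplyConnected D)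
    (hne : D ≠ Set.univ) {z₀ : ℂ} (hz₀ : z₀ ∈ D) :
    ∃ φ : ℂ → ℂ, IsConformalOnto φ D ∧ φ 0 = z₀ := by
  -- The competitors of the extremal problem; the quantity maximized is `‖deriv g z₀‖`.
  set 𝓕 : Set (ℂ → ℂ) := {g | DifferentiableOn ℂ g D ∧ Set.MapsTo g D (Metric.ball 0 1) ∧
    Set.InjOn g D ∧ g z₀ = 0} with h𝓕
  have hne𝓕 : 𝓕.Nonempty := by
    obtain ⟨f, hfd', hfm, hfi⟩ := exists_injOn_mapsTo_unitBall hD hDc hne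
    have ha : ‖-f z₀‖ < 1 := by simpa using hfm hz₀
    refine ⟨fun z => diskAutomorphism (-f z₀) (f z),
      diskAutomorphism.differentiableOn_comp ha hfd' hfm,
      diskAutomorphism.mapsTo_comp ha hfm, ?_, by simp [diskAutomorphism]⟩
    intro x hx y hy hxy
    exact hfi hx hy (diskAutomorphism.injOn ha (hfm hx) (hfm hy) hxy)
  set S : Set ℝ := (fun g => ‖deriv g z₀‖) '' 𝓕 with hS
  have hSbdd : BddAbove S := by
    obtain ⟨r, hr, hball⟩ := Metric.isOpen_iff.1 hD z₀ hz₀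
    refine ⟨1 / r, ?_⟩
    rintro _ ⟨g, ⟨hg, hgm, -, hg0⟩, rfl⟩
    refine Complex.norm_deriv_le_div_of_mapsTo_ball (hg.mono hball) ?_ hr
    intro z hz
    rw [hg0]
    exact Metric.ball_subset_closedBall (hgm (hball hz))
  have hSne : S.Nonempty := hne𝓕.image _
  obtain ⟨u, -, hu, huS⟩ := exists_seq_tendsto_sSup hSne hSbdd
  choose F hF hFu using huS
  have hFd : ∀ n, DifferentiableOn ℂ (F n) D := fun n => (hF n).1
  obtain ⟨g, hg⟩ := exists_tendstoLocallyUniformlyOn_of_mapsTo_ball (Filter.hyperfilter ℕ) hD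
    hFd (fun n => (hF n).2.1)
  have hgd : DifferentiableOn ℂ g D := hg.differentiableOn (Filter.Eventually.of_forall hFd) hD
  have hg' : ‖deriv g z₀‖ = sSup S := by
    have h1 := ((hg.deriv (Filter.Eventually.of_forall hFd) hD).tendsto_at hz₀).norm
    have h2 : Filter.Tendsto u (Filter.hyperfilter ℕ) (𝓝 (sSup S)) :=
      hu.mono_left Nat.hyperfilter_le_atTop
    refine tendsto_nhds_unique h1 (h2.congr fun n => (hFu n).symm)
  -- A positive supremum makes the limit nonconstant, as Hurwitz's theorem requires.
  have hpos : 0 < sSup S := by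
    obtain ⟨k, hk⟩ := hne𝓕
    exact (norm_pos_iff.2 (deriv_ne_zero_of_injOn hD hk.1 hk.2.2.1 hz₀)).trans_le
      (le_csSup hSbdd ⟨k, hk, rfl⟩)
  have hg0' : deriv g z₀ ≠ 0 := by rw [← norm_pos_iff, hg']; exact hpos
  have hDp : IsPreconnected D := hDc.isPathConnected.isConnected.isPreconnected
  have hginj : Set.InjOn g D := injOn_of_tendstoLocallyUniformlyOn hD hDp hFd
    (fun n => (hF n).2.2.1) hg hz₀ hg0'
  have hg0 : g z₀ = 0 := by
    refine tendsto_nhds_unique (hg.tendsto_at hz₀) ?_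
    simp only [(hF _).2.2.2]
    exact tendsto_const_nhds
  -- The limit only gives `‖g z‖ ≤ 1`; equality would make `g` constant by the maximum principle,
  -- but `g z₀ = 0`.
  have hgm : Set.MapsTo g D (Metric.ball 0 1) := by
    have hle : ∀ z ∈ D, ‖g z‖ ≤ 1 := fun z hz => le_of_tendsto (hg.tendsto_at hz).norm
      (Filter.Eventually.of_forall fun n => (mem_ball_zero_iff.1 ((hF n).2.1 hz)).le)
    intro z hz
    rw [mem_ball_zero_iff]
    refine (hle z hz).lt_of_ne fun h1 => ?_
    have hmax : IsMaxOn (norm ∘ g) D z := fun w hw => by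
      simpa [h1] using hle w hw
    have := Complex.eqOn_of_isPreconnected_of_isMaxOn_norm hDp hD hgd hz hmax hz₀
    rw [hg0] at this
    rw [Function.const_apply] at this
    rw [← this, norm_zero] at h1
    exact zero_ne_one h1
  have hsurj : Set.SurjOn g D (Metric.ball 0 1) := by
    intro w hw
    by_contra hmiss
    obtain ⟨k, hk1, hk2, hk3, hk4, hk5⟩ := exists_norm_deriv_lt_of_notMem_image hD hDc hz₀ hgd hgm
      hginj hg0 (mem_ball_zero_iff.1 hw) hmiss
    rw [hg'] at hk5
    exact hk5.not_ge (le_csSup hSbdd ⟨k, ⟨hk1, hk2, hk3, hk4⟩, rfl⟩)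
  have hbij : Set.BijOn g D (Metric.ball 0 1) := ⟨hgm, hginj, hsurj⟩
  have hinv := hbij.invOn_invFunOn
  refine ⟨Function.invFunOn g D, ⟨?_, ?_⟩, ?_⟩
  · intro w hw
    obtain ⟨z, hz, rfl⟩ := hsurj hw
    have hstrict : HasStrictDerivAt g (deriv g z) z :=
      (hgd.analyticAt (hD.mem_nhds hz)).hasStrictDerivAt
    have := hstrict.to_local_left_inverse (deriv_ne_zero_of_injOn hD hgd hginj hz)
      (g := Function.invFunOn g D)
      (Filter.eventually_of_mem (hD.mem_nhds hz) fun x hx => hinv.1 hx)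
    exact this.hasDerivAt.differentiableAt.differentiableWithinAt
  · exact hinv.symm.bijOn (fun w hw => Function.invFunOn_mem (hsurj hw)) hgm
  · rw [← hg0]; exact hinv.1 hz₀

/-! ### Real linear maps and Wirtinger derivatives. -/

/-- The real linear map `v ↦ a v + b conj v`. -/
noncomputable def realLinearMap (a b : ℂ) : ℂ →L[ℝ] ℂ :=
  a • ContinuousLinearMap.id ℝ ℂ + b • (Complex.conjCLE : ℂ →L[ℝ] ℂ)

@[simp]
theorem realLinearMap_apply (a b v : ℂ) : realLinearMap a b v = a * v + b * conj v := by
  simp [realLinearMap]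

theorem wirtingerDz_of_hasFDerivAt {f : ℂ → ℂ} {a b z : ℂ}
    (h : HasFDerivAt f (realLinearMap a b) z) : wirtingerDz f z = a := by
  rw [wirtingerDz, h.fderiv, realLinearMap_apply, realLinearMap_apply, map_one, Complex.conj_I]
  linear_combination (-a + b) / 2 * Complex.I_sq

theorem wirtingerDzBar_of_hasFDerivAt {f : ℂ → ℂ} {a b z : ℂ}
    (h : HasFDerivAt f (realLinearMap a b) z) : wirtingerDzBar f z = b := by
  rw [wirtingerDzBar, h.fderiv, realLinearMap_apply, realLinearMap_apply, map_one, Complex.conj_I]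
  linear_combination (a - b) / 2 * Complex.I_sq

theorem harmonicJacobian_of_hasFDerivAt {f : ℂ → ℂ} {a b z : ℂ}
    (h : HasFDerivAt f (realLinearMap a b) z) : harmonicJacobian f z = ‖a‖ ^ 2 - ‖b‖ ^ 2 := by
  rw [harmonicJacobian, wirtingerDz_of_hasFDerivAt h, wirtingerDzBar_of_hasFDerivAt h]

theorem det_realLinearMap (a b : ℂ) : (realLinearMap a b).det = ‖a‖ ^ 2 - ‖b‖ ^ 2 := by
  have h : HasFDerivAt (realLinearMap a b) (realLinearMap a b) 0 := (realLinearMap a b).hasFDerivAt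
  rw [← harmonicJacobian_of_hasFDerivAt h, harmonicJacobian_eq_det, h.fderiv]

theorem HasDerivAt.hasFDerivAt_realLinearMap {f : ℂ → ℂ} {f' z : ℂ} (h : HasDerivAt f f' z) :
    HasFDerivAt f (realLinearMap f' 0) z := by
  refine (h.hasFDerivAt.restrictScalars ℝ).congr_fderiv ?_
  ext v
  simp [mul_comm]

theorem hasFDerivAt_add_conj {h g : ℂ → ℂ} {h' g' z : ℂ} (hh : HasDerivAt h h' z)
    (hg : HasDerivAt g g' z) :
    HasFDerivAt (fun w => h w + conj (g w)) (realLinearMap h' (conj g')) z := by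
  have h1 := hh.hasFDerivAt_realLinearMap
  have h2 : HasFDerivAt (fun w => conj (g w))
      ((Complex.conjCLE : ℂ →L[ℝ] ℂ).comp (realLinearMap g' 0)) z :=
    (Complex.conjCLE : ℂ →L[ℝ] ℂ).hasFDerivAt.comp z hg.hasFDerivAt_realLinearMap
  refine (h1.add h2).congr_fderiv ?_
  ext v
  simp

theorem norm_mul_le_norm_realLinearMap_one (c w : ℂ) :
    (1 - ‖c‖) * ‖w‖ ≤ ‖realLinearMap 1 c w‖ := by
  rw [realLinearMap_apply, one_mul]
  have := norm_sub_le_norm_add w (c * conj w)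
  rw [norm_mul, RCLike.norm_conj] at this
  linarith

theorem injective_realLinearMap_one {c : ℂ} (hc : ‖c‖ < 1) :
    Function.Injective (realLinearMap 1 c) := by
  rw [injective_iff_map_eq_zero]
  intro w hw
  have := norm_mul_le_norm_realLinearMap_one c w
  rw [hw, norm_zero] at this
  have h1 : ‖w‖ ≤ 0 := by
    by_contra! h
    nlinarith
  simpa using h1

theorem surjective_realLinearMap_one {c : ℂ} (hc : ‖c‖ < 1) :
    Function.Surjective (realLinearMap 1 c) := by
  have h := injective_realLinearMap_one hc
  exact (LinearMap.injective_iff_surjective (f := (realLinearMap 1 c : ℂ →ₗ[ℝ] ℂ))).1 h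

/-! ### Gronwall's area theorem. -/

theorem isPreconnected_compl_closedBall_zero {R : ℝ} (hR : 0 < R) :
    IsPreconnected (Metric.closedBall (0 : ℂ) R)ᶜ := by
  have h : (Metric.closedBall (0 : ℂ) R)ᶜ =
      (fun p : ℝ × ℝ => (p.1 : ℂ) * Complex.exp (p.2 * Complex.I)) '' (Set.Ioi R ×ˢ Set.univ) := by
    ext w
    simp only [Set.mem_compl_iff, Metric.mem_closedBall, dist_zero_right, not_le, Set.mem_image,
      Set.mem_prod, Set.mem_Ioi, Set.mem_univ, and_true, Prod.exists]
    constructor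
    · intro hw
      exact ⟨‖w‖, w.arg, hw, Complex.norm_mul_exp_arg_mul_I w⟩
    · rintro ⟨ρ, θ, hρ, rfl⟩
      rw [norm_mul, Complex.norm_exp_ofReal_mul_I, mul_one, Complex.norm_real,
        Real.norm_of_nonneg (hR.trans hρ).le]
      exact hρ
  rw [h]
  exact (isPreconnected_Ioi.prod isPreconnected_univ).image _ (by fun_prop)

/-- Lower bound for the quadratic mean of a holomorphic function on a circle by means of its
first coefficients. -/
theorem le_circleAverage_norm_sq {b : ℂ} {e : ℂ → ℂ} {ρ : ℝ} (hρ0 : 0 < ρ)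
    (he : DifferentiableOn ℂ e (Metric.closedBall 0 ρ)) :
    1 + ‖b‖ ^ 2 * ρ ^ 4 ≤
      Real.circleAverage (fun z => ‖-1 + b * z ^ 2 + z ^ 3 * e z‖ ^ 2) 0 ρ := by
  -- On `|z| = ρ`, where `conj z = ρ²/z`, every cross term in the expanded square is the real part
  -- of a holomorphic function. Thus `Re G` is the integrand without `|z³ e|²`, and its mean is `G
  -- 0`.
  set G : ℂ → ℂ := fun z => (1 + ‖b‖ ^ 2 * ρ ^ 4 : ℝ) +
    2 * (-(b * z ^ 2) - z ^ 3 * e z + conj b * ρ ^ 4 * (z * e z)) with hG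
  have hGd : DifferentiableOn ℂ G (Metric.closedBall 0 ρ) := by fun_prop
  have hGa : Real.circleAverage G 0 ρ = (1 + ‖b‖ ^ 2 * ρ ^ 4 : ℝ) := by
    rw [DiffContOnCl.circleAverage]
    · simp [hG]
    · rw [abs_of_pos hρ0]
      exact (hGd.mono (by rw [closure_ball _ hρ0.ne'])).diffContOnCl
  have hsph : Metric.sphere (0 : ℂ) |ρ| ⊆ Metric.closedBall 0 ρ := by
    rw [abs_of_pos hρ0]; exact Metric.sphere_subset_closedBall
  have hGi : CircleIntegrable G 0 ρ := (hGd.continuousOn.mono hsph).circleIntegrable'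
  have hre : Real.circleAverage (Complex.reCLM ∘ G) 0 ρ = 1 + ‖b‖ ^ 2 * ρ ^ 4 := by
    rw [Complex.reCLM.circleAverage_comp_comm hGi, hGa, Complex.reCLM_apply, Complex.ofReal_re]
  rw [← hre]
  refine Real.circleAverage_mono ?_ ?_ ?_
  · exact ((Complex.reCLM.continuous.comp_continuousOn hGd.continuousOn).mono hsph).circleIntegrable'
  · have : DifferentiableOn ℂ (fun z => -1 + b * z ^ 2 + z ^ 3 * e z) (Metric.closedBall 0 ρ) := by
      fun_prop
    exact ((this.continuousOn.norm.pow 2).mono hsph).circleIntegrable'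
  · intro z hz
    have hz' : z * conj z = (ρ : ℂ) ^ 2 := by
      rw [abs_of_pos hρ0, mem_sphere_zero_iff_norm] at hz
      rw [Complex.mul_conj, Complex.normSq_eq_norm_sq, hz]; push_cast; rfl
    have key : ((‖-1 + b * z ^ 2 + z ^ 3 * e z‖ ^ 2 : ℝ) : ℂ) =
        (1 + ‖b‖ ^ 2 * ρ ^ 4 : ℝ) + ((-(b * z ^ 2) - z ^ 3 * e z + conj b * ρ ^ 4 * (z * e z)) +
        conj (-(b * z ^ 2) - z ^ 3 * e z + conj b * ρ ^ 4 * (z * e z))) +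
        ((‖z ^ 3 * e z‖ ^ 2 : ℝ) : ℂ) := by
      have hn : ∀ w : ℂ, ((‖w‖ ^ 2 : ℝ) : ℂ) = w * conj w := by
        intro w; rw [Complex.mul_conj, Complex.normSq_eq_norm_sq]
      push_cast
      simp only [← Complex.ofReal_pow, hn]
      push_cast
      simp only [map_add, map_sub, map_neg, map_mul, map_pow, map_one, Complex.conj_conj,
        Complex.conj_ofReal]
      have h4 : (ρ : ℂ) ^ 4 = (z * conj z) ^ 2 := by rw [hz']; ring
      rw [h4]
      ring
    have key2 := congrArg Complex.re key
    simp only [Complex.add_re, Complex.ofReal_re, Complex.conj_re] at key2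
    have hpos : 0 ≤ ‖z ^ 3 * e z‖ ^ 2 := by positivity
    simp only [Function.comp_apply, Complex.reCLM_apply, hG, Complex.add_re, Complex.ofReal_re]
    rw [key2]
    have : ∀ w : ℂ, (2 * w).re = w.re + w.re := by intro w; rw [two_mul, Complex.add_re]
    rw [this]
    simp only [Complex.add_re]
    linarith

/-- Integration in polar coordinates. The right side is a lower integral in `[0, ∞]`, so `v` need
not be integrable up to the unit circle. -/
theorem ofReal_integral_le_lintegral_annulus {r : ℝ} (hr : 0 < r) (hr1 : r ≤ 1) {v : ℂ → ℝ}
    (hv : ContinuousOn v (Metric.ball 0 1 \ Metric.closedBall 0 r)) (hv0 : ∀ z, 0 ≤ v z)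
    {m : ℝ → ℝ} (hm : ContinuousOn m (Set.Icc r 1)) (hm0 : ∀ ρ, 0 ≤ m ρ)
    (hle : ∀ ρ ∈ Set.Ioo r 1, m ρ ≤ Real.circleAverage v 0 ρ) :
    ENNReal.ofReal (2 * Real.pi * ∫ ρ in r..1, ρ * m ρ) ≤
      ∫⁻ z in Metric.ball 0 1 \ Metric.closedBall 0 r, ENNReal.ofReal (v z) := by
  set A : Set ℂ := Metric.ball 0 1 \ Metric.closedBall 0 r with hA
  have hAmeas : MeasurableSet A := measurableSet_ball.diff measurableSet_closedBall
  set T : Set (ℝ × ℝ) := Set.Ioo r 1 ×ˢ Set.Ioo (-Real.pi) Real.pi with hT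
  have hTmeas : MeasurableSet T := measurableSet_Ioo.prod measurableSet_Ioo
  have hTA : ∀ p ∈ T, Complex.polarCoord.symm p ∈ A := by
    rintro ⟨ρ, θ⟩ ⟨⟨h1, h2⟩, -⟩
    have h3 : ‖Complex.polarCoord.symm (ρ, θ)‖ = ρ := by
      rw [Complex.norm_polarCoord_symm, abs_of_pos (hr.trans h1)]
    simp only [hA, Set.mem_sdiff, mem_ball_zero_iff, mem_closedBall_zero_iff, h3, not_le]
    exact ⟨h2, h1⟩
  have hTt : T ⊆ polarCoord.target := by
    rintro ⟨ρ, θ⟩ ⟨⟨h1, h2⟩, h3⟩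
    exact ⟨hr.trans h1, h3⟩
  have hpc : Continuous fun p : ℝ × ℝ => Complex.polarCoord.symm p := by
    simp only [Complex.polarCoord_symm_apply]; fun_prop
  have hcont : ContinuousOn (fun p : ℝ × ℝ => p.1 * v (Complex.polarCoord.symm p)) T :=
    continuous_fst.continuousOn.mul (hv.comp hpc.continuousOn hTA)
  have hstep1 : ∫⁻ p in T, ENNReal.ofReal (p.1 * v (Complex.polarCoord.symm p)) ≤
      ∫⁻ z in A, ENNReal.ofReal (v z) := by
    rw [← MeasureTheory.lintegral_indicator hAmeas, ← Complex.lintegral_comp_polarCoord_symm]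
    refine le_trans ?_ (MeasureTheory.lintegral_mono_set hTt)
    refine MeasureTheory.setLIntegral_mono_ae' hTmeas (Filter.Eventually.of_forall fun p hp => ?_)
    rw [Set.indicator_of_mem (hTA p hp), smul_eq_mul,
      ENNReal.ofReal_mul (hr.trans hp.1.1).le]
  refine le_trans ?_ hstep1
  rw [hT, MeasureTheory.Measure.volume_eq_prod, ← MeasureTheory.Measure.prod_restrict,
    MeasureTheory.lintegral_prod]
  swap
  · rw [MeasureTheory.Measure.prod_restrict, ← MeasureTheory.Measure.volume_eq_prod]
    exact (hcont.aemeasurable hTmeas).ennreal_ofReal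
  have hinner : ∀ ρ ∈ Set.Ioo r 1, ENNReal.ofReal (2 * Real.pi * (ρ * m ρ)) ≤
      ∫⁻ θ in Set.Ioo (-Real.pi) Real.pi, ENNReal.ofReal (ρ * v (Complex.polarCoord.symm (ρ, θ))) := by
    intro ρ hρ
    have hρ0 : 0 < ρ := hr.trans hρ.1
    have hsymm : ∀ θ : ℝ, Complex.polarCoord.symm (ρ, θ) = circleMap 0 ρ θ := by
      intro θ
      rw [Complex.polarCoord_symm_apply, circleMap, Complex.exp_mul_I, zero_add]
      push_cast; rfl
    simp only [hsymm]
    have hvc : Continuous fun θ : ℝ => v (circleMap 0 ρ θ) := by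
      refine hv.comp_continuous (continuous_circleMap 0 ρ) fun θ => ?_
      have : ‖circleMap 0 ρ θ‖ = ρ := by simp [abs_of_pos hρ0]
      simp only [hA, Set.mem_sdiff, mem_ball_zero_iff, mem_closedBall_zero_iff, this, not_le]
      exact ⟨hρ.2, hρ.1⟩
    rw [← MeasureTheory.ofReal_integral_eq_lintegral_ofReal]
    · apply ENNReal.ofReal_le_ofReal
      rw [← MeasureTheory.integral_Ioc_eq_integral_Ioo,
        ← intervalIntegral.integral_of_le (by linarith [Real.pi_pos]),
        intervalIntegral.integral_const_mul]
      have hper : Function.Periodic (fun θ : ℝ => v (circleMap 0 ρ θ)) (2 * Real.pi) := by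
        intro θ
        simp only [periodic_circleMap 0 ρ θ]
      have hshift := hper.intervalIntegral_add_eq (-Real.pi) 0
      rw [show -Real.pi + 2 * Real.pi = Real.pi by ring, zero_add] at hshift
      rw [hshift]
      have h1 := hle ρ hρ
      rw [Real.circleAverage_def, smul_eq_mul, le_inv_mul_iff₀ Real.two_pi_pos] at h1
      nlinarith
    · exact ((continuous_const.mul hvc).integrableOn_Icc (a := -Real.pi) (b := Real.pi)).mono_set
        Set.Ioo_subset_Icc_self
    · exact Filter.Eventually.of_forall fun θ => mul_nonneg hρ0.le (hv0 _)
  refine le_trans ?_ (MeasureTheory.setLIntegral_mono_ae' measurableSet_Ioo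
    (Filter.Eventually.of_forall hinner))
  rw [← MeasureTheory.ofReal_integral_eq_lintegral_ofReal]
  · rw [← MeasureTheory.integral_Ioc_eq_integral_Ioo,
      ← intervalIntegral.integral_of_le hr1, intervalIntegral.integral_const_mul]
  · exact ((continuousOn_const.mul (continuousOn_id.mul hm)).integrableOn_Icc).mono_set
      Set.Ioo_subset_Icc_self
  · refine (MeasureTheory.ae_restrict_iff' measurableSet_Ioo).2
      (Filter.Eventually.of_forall fun ρ hρ => ?_)
    have := hm0 ρ
    have := hr.trans hρ.1
    simp only [Pi.zero_apply]
    positivity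

section Area

variable {b : ℂ} {e : ℂ → ℂ}

theorem hasDerivAt_inv_add (he : DifferentiableOn ℂ e (Metric.ball 0 1)) {z : ℂ}
    (hz : z ∈ Metric.ball (0 : ℂ) 1) (hz0 : z ≠ 0) :
    HasDerivAt (fun z => z⁻¹ + b * z + z ^ 2 * e z)
      ((-1 + b * z ^ 2 + z ^ 3 * (2 * e z + z * deriv e z)) / z ^ 2) z := by
  have h1 := (he.differentiableAt (Metric.isOpen_ball.mem_nhds hz)).hasDerivAt
  have h2 := ((hasDerivAt_inv hz0).add ((hasDerivAt_id z).const_mul b)).add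
    ((hasDerivAt_pow 2 z).mul h1)
  refine h2.congr_deriv ?_
  field_simp
  ring

/-- By injectivity the area is the integral of `|F'|²`, whose mean on `|z| = ρ` is at least `ρ⁻⁴ +
|b|²`; the left side is `2π ∫ ρ (ρ⁻⁴ + |b|²)` over `[r, 1]`. -/
theorem ofReal_le_volume_image_annulus (he : DifferentiableOn ℂ e (Metric.ball 0 1))
    (hinj : Set.InjOn (fun z => z⁻¹ + b * z + z ^ 2 * e z) (Metric.ball 0 1 \ {0}))
    {r : ℝ} (hr : 0 < r) (hr1 : r ≤ 1) :
    ENNReal.ofReal (Real.pi * (1 / r ^ 2 - 1 + ‖b‖ ^ 2 * (1 - r ^ 2))) ≤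
      MeasureTheory.volume ((fun z => z⁻¹ + b * z + z ^ 2 * e z) ''
        (Metric.ball 0 1 \ Metric.closedBall 0 r)) := by
  set A : Set ℂ := Metric.ball 0 1 \ Metric.closedBall 0 r with hA
  have hAsub : A ⊆ Metric.ball 0 1 \ {0} := by
    rintro z ⟨h1, h2⟩
    refine ⟨h1, ?_⟩
    rintro rfl
    exact h2 (Metric.mem_closedBall_self hr.le)
  have hAmeas : MeasurableSet A := measurableSet_ball.diff measurableSet_closedBall
  set F' : ℂ → ℂ := fun z => (-1 + b * z ^ 2 + z ^ 3 * (2 * e z + z * deriv e z)) / z ^ 2 with hF'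
  rw [← MeasureTheory.lintegral_abs_det_fderiv_eq_addHaar_image MeasureTheory.volume hAmeas
    (f' := fun z => realLinearMap (F' z) 0)
    (fun z hz => (hasDerivAt_inv_add he (hAsub hz).1
      (hAsub hz).2).hasFDerivAt_realLinearMap.hasFDerivWithinAt) (hinj.mono hAsub)]
  simp only [det_realLinearMap, norm_zero, ne_eq, OfNat.ofNat_ne_zero, not_false_eq_true,
    zero_pow, sub_zero, abs_sq]
  have hed : DifferentiableOn ℂ (deriv e) (Metric.ball 0 1) := he.deriv Metric.isOpen_ball
  have hu : DifferentiableOn ℂ (fun z => 2 * e z + z * deriv e z) (Metric.ball 0 1) := by fun_prop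
  refine le_trans (le_of_eq ?_) (ofReal_integral_le_lintegral_annulus hr hr1
    (v := fun z => ‖F' z‖ ^ 2) (m := fun ρ => ((ρ ^ 4)⁻¹ + ‖b‖ ^ 2)) ?_ ?_ ?_ ?_ ?_)
  · congr 1
    have hint : ∫ ρ in r..1, ρ * ((ρ ^ 4)⁻¹ + ‖b‖ ^ 2) =
        (-(1 ^ 2)⁻¹ / 2 + ‖b‖ ^ 2 * 1 ^ 2 / 2) - (-(r ^ 2)⁻¹ / 2 + ‖b‖ ^ 2 * r ^ 2 / 2) := by
      refine intervalIntegral.integral_eq_sub_of_hasDerivAt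
        (f := fun ρ => -(ρ ^ 2)⁻¹ / 2 + ‖b‖ ^ 2 * ρ ^ 2 / 2) ?_ ?_
      · intro ρ hρ
        rw [Set.uIcc_of_le hr1] at hρ
        have hρ0 : ρ ≠ 0 := (hr.trans_le hρ.1).ne'
        have h1 := (((hasDerivAt_pow 2 ρ).fun_inv (pow_ne_zero 2 hρ0)).neg.div_const 2).add
          (((hasDerivAt_pow 2 ρ).const_mul (‖b‖ ^ 2)).div_const 2)
        refine h1.congr_deriv ?_
        field_simp
        ring
      · refine ContinuousOn.intervalIntegrable fun ρ hρ => ?_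
        rw [Set.uIcc_of_le hr1] at hρ
        have hρ0 : ρ ^ 4 ≠ 0 := pow_ne_zero 4 (hr.trans_le hρ.1).ne'
        exact (continuousAt_id.mul (((continuousAt_id.pow 4).inv₀ hρ0).add
          continuousAt_const)).continuousWithinAt
    rw [hint]
    field_simp
    ring
  · refine (ContinuousOn.div ?_ (by fun_prop) fun z hz => pow_ne_zero 2 (hAsub hz).2).norm.pow 2
    have : DifferentiableOn ℂ (fun z => -1 + b * z ^ 2 + z ^ 3 * (2 * e z + z * deriv e z))
        (Metric.ball 0 1) := by fun_prop
    exact this.continuousOn.mono Set.sdiff_subset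
  · exact fun z => by positivity
  · refine ContinuousOn.add (ContinuousOn.inv₀ (by fun_prop) fun ρ hρ => ?_) continuousOn_const
    exact pow_ne_zero 4 (hr.trans_le hρ.1).ne'
  · intro ρ; positivity
  · intro ρ hρ
    have hρ0 : 0 < ρ := hr.trans hρ.1
    have h1 := le_circleAverage_norm_sq (b := b) hρ0
      (hu.mono (Metric.closedBall_subset_ball hρ.2))
    have h2 : Real.circleAverage (fun z => ‖F' z‖ ^ 2) 0 ρ = Real.circleAverage
        ((ρ ^ 4)⁻¹ • fun z => ‖-1 + b * z ^ 2 + z ^ 3 * (2 * e z + z * deriv e z)‖ ^ 2) 0 ρ := by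
      refine Real.circleAverage_congr_sphere fun z hz => ?_
      rw [abs_of_pos hρ0, mem_sphere_zero_iff_norm] at hz
      simp only [hF', Pi.smul_apply, smul_eq_mul, norm_div, norm_pow, hz, div_pow]
      rw [div_eq_inv_mul, ← pow_mul]
    rw [h2, Real.circleAverage_smul, smul_eq_mul]
    have h3 := mul_le_mul_of_nonneg_left h1 (inv_nonneg.2 (pow_nonneg hρ0.le 4))
    refine le_trans (le_of_eq ?_) h3
    field_simp

/-- On `|z| = r` one has `z⁻¹ + b z = L(z⁻¹)` with `L v = v + b r² conj v`, so the circle's image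
lies in an ellipse slightly larger than `L` of the disk of radius `1/r`. The exterior of that
ellipse is connected and is filled by the image of `0 < |z| < r`; injectivity confines the annulus
to the ellipse. -/
theorem image_annulus_subset (he : DifferentiableOn ℂ e (Metric.ball 0 1))
    (hinj : Set.InjOn (fun z => z⁻¹ + b * z + z ^ 2 * e z) (Metric.ball 0 1 \ {0}))
    {C r : ℝ} (hr : 0 < r) (hr1 : r < 1) (hC : ∀ z ∈ Metric.closedBall (0 : ℂ) r, ‖e z‖ ≤ C)
    (hbr : ‖b * r ^ 2‖ ≤ 1 / 2) :
    (fun z => z⁻¹ + b * z + z ^ 2 * e z) '' (Metric.ball 0 1 \ Metric.closedBall 0 r) ⊆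
      realLinearMap 1 (b * r ^ 2) '' Metric.closedBall 0 (1 / r + 2 * C * r ^ 2) := by
  set F : ℂ → ℂ := fun z => z⁻¹ + b * z + z ^ 2 * e z with hF
  set L := realLinearMap 1 (b * r ^ 2) with hL
  have hc1 : ‖b * (r : ℂ) ^ 2‖ < 1 := hbr.trans_lt (by norm_num)
  have hLi : Function.Injective L := injective_realLinearMap_one hc1
  have hLs : Function.Surjective L := surjective_realLinearMap_one hc1
  have hC0 : 0 ≤ C := (norm_nonneg _).trans (hC 0 (Metric.mem_closedBall_self hr.le))
  set R := 1 / r + 2 * C * r ^ 2 with hR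
  have hR0 : 0 < R := by positivity
  have hsphere : ∀ z, ‖z‖ = r → F z ∈ L '' Metric.closedBall 0 R := by
    intro z hz
    have hz0 : z ≠ 0 := by
      rintro rfl
      rw [norm_zero] at hz
      exact hr.ne hz
    -- The remainder is absorbed into the argument: `F z = L (z⁻¹ + w)`, and `‖w‖ ≤ 2 C r²` because
    -- `L` shrinks norms at most by half.
    obtain ⟨w, hw⟩ := hLs (z ^ 2 * e z)
    refine ⟨z⁻¹ + w, ?_, ?_⟩
    · rw [mem_closedBall_zero_iff]
      have h1 := norm_mul_le_norm_realLinearMap_one (b * r ^ 2) w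
      rw [← hL, hw, norm_mul (z ^ 2), norm_pow z, hz] at h1
      have h2 := hC z (mem_closedBall_zero_iff.2 hz.le)
      have h3 : r ^ 2 * ‖e z‖ ≤ r ^ 2 * C := mul_le_mul_of_nonneg_left h2 (by positivity)
      have h4 : 1 / 2 * ‖w‖ ≤ (1 - ‖b * (r : ℂ) ^ 2‖) * ‖w‖ :=
        mul_le_mul_of_nonneg_right (by linarith) (norm_nonneg w)
      have h5 := norm_add_le z⁻¹ w
      rw [norm_inv, hz, inv_eq_one_div r] at h5
      rw [hR]
      linarith
    · rw [map_add, hw, hL, realLinearMap_apply, map_inv₀, one_mul]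
      have h6 : (r : ℂ) ^ 2 = z * conj z := by
        rw [Complex.mul_conj, Complex.normSq_eq_norm_sq, hz]; push_cast; rfl
      have h7 : conj z ≠ 0 := by simpa using hz0
      rw [h6, hF]
      field_simp
  set E : Set ℂ := (L '' Metric.closedBall 0 R)ᶜ with hE
  have hEpre : IsPreconnected E := by
    rw [hE, ← Set.image_compl_eq ⟨hLi, hLs⟩]
    exact (isPreconnected_compl_closedBall_zero hR0).image _ L.continuous.continuousOn
  -- The image of `0 < |z| ≤ r` with the denominator cleared: `z = 0` gives `0 = 1` and contributes
  -- nothing, and `T` is closed as a projection along a compact disk.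
  set T : Set ℂ := {w | ∃ z ∈ Metric.closedBall (0 : ℂ) r, z * w = 1 + b * z ^ 2 + z ^ 3 * e z}
    with hT
  have hcbsub : Metric.closedBall (0 : ℂ) r ⊆ Metric.ball 0 1 := Metric.closedBall_subset_ball hr1
  have hTclosed : IsClosed T := by
    have hcomp := isCompact_iff_compactSpace.1 (isCompact_closedBall (0 : ℂ) r)
    have hecont : Continuous fun z : Metric.closedBall (0 : ℂ) r => e z :=
      (he.continuousOn.mono hcbsub).domRestrict
    have hcl : IsClosed {p : Metric.closedBall (0 : ℂ) r × ℂ |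
        (p.1 : ℂ) * p.2 = 1 + b * (p.1 : ℂ) ^ 2 + (p.1 : ℂ) ^ 3 * e p.1} := by
      refine isClosed_eq (by fun_prop) ?_
      have := hecont.comp (continuous_fst (X := Metric.closedBall (0 : ℂ) r) (Y := ℂ))
      have h2 : Continuous fun p : Metric.closedBall (0 : ℂ) r × ℂ => (p.1 : ℂ) := by fun_prop
      exact (continuous_const.add (continuous_const.mul (h2.pow 2))).add ((h2.pow 3).mul this)
    have := isClosedMap_snd_of_compactSpace _ hcl
    convert this using 1
    ext w
    simp [hT]
  have hTF : ∀ w, w ∈ T ↔ ∃ z ∈ Metric.closedBall (0 : ℂ) r, z ≠ 0 ∧ F z = w := by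
    intro w
    refine exists_congr fun z => and_congr_right fun _ => ?_
    by_cases hz0 : z = 0
    · simp [hz0]
    · simp only [ne_eq, hz0, not_false_eq_true, true_and, hF]
      constructor
      · intro h
        field_simp
        linear_combination -h
      · rintro rfl
        field_simp
  set V : Set ℂ := F '' (Metric.ball 0 r \ {0}) with hV
  have hballs : Metric.ball (0 : ℂ) r \ {0} ⊆ Metric.ball 0 1 \ {0} :=
    Set.sdiff_subset_sdiff_left (Metric.ball_subset_ball hr1.le)
  have hpo : IsOpen (Metric.ball (0 : ℂ) 1 \ {0}) := Metric.isOpen_ball.sdiff isClosed_singleton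
  have hFd : DifferentiableOn ℂ F (Metric.ball 0 1 \ {0}) := fun z hz =>
    (hasDerivAt_inv_add he hz.1 hz.2).differentiableAt.differentiableWithinAt
  have hVopen : IsOpen V := by
    rw [isOpen_iff_mem_nhds]
    rintro _ ⟨z, hz, rfl⟩
    have hst : HasStrictDerivAt F (deriv F z) z :=
      (hFd.analyticAt (hpo.mem_nhds (hballs hz))).hasStrictDerivAt
    rw [← hst.map_nhds_eq (deriv_ne_zero_of_injOn hpo hFd hinj (hballs hz))]
    exact Filter.image_mem_map ((Metric.isOpen_ball.sdiff isClosed_singleton).mem_nhds hz)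
  have hVT : ∀ w ∈ E, w ∈ T → w ∈ V := by
    intro w hwE hwT
    obtain ⟨z, hz, hz0, rfl⟩ := (hTF w).1 hwT
    refine ⟨z, ⟨?_, hz0⟩, rfl⟩
    rw [mem_closedBall_zero_iff] at hz
    rw [mem_ball_zero_iff]
    exact hz.lt_of_ne fun h => hwE (hsphere z h)
  have hTV : V ⊆ T := by
    rintro _ ⟨z, hz, rfl⟩
    exact (hTF _).2 ⟨z, Metric.ball_subset_closedBall hz.1, hz.2, rfl⟩
  -- The pole: `‖F z‖ → ∞` as `z → 0`, while the ellipse is bounded.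
  have hmeet : (E ∩ V).Nonempty := by
    have hbdd : Bornology.IsBounded (L '' Metric.closedBall 0 R) :=
      ((isCompact_closedBall (0 : ℂ) R).image L.continuous).isBounded
    obtain ⟨M, hM⟩ := hbdd.exists_norm_le
    have hrest : Filter.Tendsto (fun z : ℂ => b * z + z ^ 2 * e z) (𝓝[≠] 0) (𝓝 (b * 0 + 0 ^ 2 * e 0)) := by
      have hec : ContinuousAt e 0 := (he.differentiableAt
        (Metric.ball_mem_nhds 0 one_pos)).continuousAt
      have : ContinuousAt (fun z : ℂ => b * z + z ^ 2 * e z) 0 := by fun_prop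
      exact this.tendsto.mono_left nhdsWithin_le_nhds
    have htop : Filter.Tendsto (fun z : ℂ => ‖z⁻¹ + (b * z + z ^ 2 * e z)‖) (𝓝[≠] 0) Filter.atTop := by
      refine Filter.tendsto_atTop_mono (fun z => ?_)
        (Filter.Tendsto.atTop_add tendsto_norm_inv_nhdsNE_zero_atTop hrest.norm.neg)
      exact norm_sub_le_norm_add z⁻¹ (b * z + z ^ 2 * e z)
    have hnear : Metric.ball (0 : ℂ) r \ {0} ∈ 𝓝[≠] (0 : ℂ) :=
      Filter.inter_mem (mem_nhdsWithin_of_mem_nhds (Metric.ball_mem_nhds 0 hr))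
        self_mem_nhdsWithin
    obtain ⟨z, h1, h2⟩ := ((htop.eventually_gt_atTop M).and hnear).exists
    refine ⟨F z, fun h => ?_, ⟨z, h2, rfl⟩⟩
    have := hM _ h
    simp only [hF, add_assoc] at this
    exact this.not_gt h1
  -- The disjoint open sets `V` and `Tᶜ` cover the connected set `E`, and `V` meets it.
  have hEV : E ⊆ V := by
    intro w hw
    by_contra hwV
    have hwT : w ∈ Tᶜ := fun h => hwV (hVT w hw h)
    obtain ⟨x, hxE, hx1, hx2⟩ := hEpre V Tᶜ hVopen hTclosed.isOpen_compl
      (fun x hx => by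
        by_cases h : x ∈ T
        · exact Or.inl (hVT x hx h)
        · exact Or.inr h) hmeet ⟨w, hw, hwT⟩
    exact hx2 (hTV hx1)
  rintro _ ⟨z, ⟨hz1, hz2⟩, rfl⟩
  by_contra hcon
  obtain ⟨y, hy, hyz⟩ := hEV hcon
  have hz0 : z ≠ 0 := by
    rintro rfl
    exact hz2 (Metric.mem_closedBall_self hr.le)
  have := hinj (hballs hy) ⟨hz1, hz0⟩ hyz
  rw [← this] at hz2
  exact hz2 (Metric.ball_subset_closedBall hy.1)

/-- Gronwall's area theorem for the first coefficient. -/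
theorem norm_le_one_of_injOn_inv_add (he : DifferentiableOn ℂ e (Metric.ball 0 1))
    (hinj : Set.InjOn (fun z => z⁻¹ + b * z + z ^ 2 * e z) (Metric.ball 0 1 \ {0})) :
    ‖b‖ ≤ 1 := by
  obtain ⟨C, hC⟩ := (isCompact_closedBall (0 : ℂ) (1 / 2)).exists_bound_of_continuousOn
    (he.continuousOn.mono (Metric.closedBall_subset_ball (by norm_num)))
  have hC0 : 0 ≤ C := (norm_nonneg _).trans (hC 0 (Metric.mem_closedBall_self (by norm_num)))
  -- The lower area bound is compared with the ellipse's area, at most `π (1/r + 2Cr²)²`. The terms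
  -- `1/r²` cancel, and `r → 0` leaves `|b|² ≤ 1`.
  have hineq : ∀ᶠ r : ℝ in 𝓝[>] 0, ‖b‖ ^ 2 * (1 - r ^ 2) ≤ 1 + 4 * C * r + 4 * C ^ 2 * r ^ 4 := by
    have h1 : ∀ᶠ r : ℝ in 𝓝 0, ‖b * (r : ℂ) ^ 2‖ < 1 / 2 := by
      have : ContinuousAt (fun r : ℝ => ‖b * (r : ℂ) ^ 2‖) 0 := by fun_prop
      exact this.eventually_lt continuousAt_const (by simp)
    filter_upwards [h1.filter_mono nhdsWithin_le_nhds, Ioo_mem_nhdsGT (show (0 : ℝ) < 1 / 2 by norm_num)]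
      with r hbr ⟨hr, hr2⟩
    have hlow := ofReal_le_volume_image_annulus he hinj hr (by linarith)
    have hup := MeasureTheory.measure_mono (μ := MeasureTheory.volume)
      (image_annulus_subset he hinj hr (by linarith)
        (fun z hz => hC z (Metric.closedBall_subset_closedBall hr2.le hz)) hbr.le)
    rw [MeasureTheory.Measure.addHaar_image_continuousLinearMap, ← ContinuousLinearMap.det,
      det_realLinearMap,
      Complex.volume_closedBall] at hup
    have hle := hlow.trans hup
    have hdet : |‖(1 : ℂ)‖ ^ 2 - ‖b * (r : ℂ) ^ 2‖ ^ 2| ≤ 1 := by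
      rw [norm_one, abs_le]
      constructor <;> nlinarith [norm_nonneg (b * (r : ℂ) ^ 2)]
    have hR0 : 0 ≤ 1 / r + 2 * C * r ^ 2 := by positivity
    have hle2 := hle.trans (mul_le_mul_left (ENNReal.ofReal_le_ofReal hdet) _)
    rw [ENNReal.ofReal_one, one_mul, ← ENNReal.ofReal_pow hR0, ← NNReal.coe_real_pi] at hle2
    rw [← ENNReal.ofReal_coe_nnreal, ← ENNReal.ofReal_mul (by positivity),
      ENNReal.ofReal_le_ofReal_iff (by positivity), mul_comm (NNReal.pi : ℝ),
      mul_le_mul_iff_left₀ (by simpa using Real.pi_pos)] at hle2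
    have hexp : (1 / r + 2 * C * r ^ 2) ^ 2 = 1 / r ^ 2 + 4 * C * r + 4 * C ^ 2 * r ^ 4 := by
      field_simp
      ring
    rw [hexp] at hle2
    linarith
  have hlim : ‖b‖ ^ 2 * (1 - 0 ^ 2) ≤ 1 + 4 * C * 0 + 4 * C ^ 2 * 0 ^ 4 := by
    refine le_of_tendsto_of_tendsto (b := 𝓝[>] (0 : ℝ))
      (f := fun r : ℝ => ‖b‖ ^ 2 * (1 - r ^ 2))
      (g := fun r : ℝ => 1 + 4 * C * r + 4 * C ^ 2 * r ^ 4) ?_ ?_ hineq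
    · exact (Continuous.tendsto (by fun_prop) (0 : ℝ)).mono_left nhdsWithin_le_nhds
    · exact (Continuous.tendsto (by fun_prop) (0 : ℝ)).mono_left nhdsWithin_le_nhds
  nlinarith [norm_nonneg b]

end Area

/-! ### Bieberbach's bound for the second coefficient. -/

theorem deriv_deriv_eq_two_mul_deriv_dslope {f : ℂ → ℂ} {U : Set ℂ} {z : ℂ} (hU : U ∈ 𝓝 z)
    (hf : DifferentiableOn ℂ f U) : deriv (deriv f) z = 2 * deriv (dslope f z) z := by
  have hk : AnalyticAt ℂ (dslope f z) z :=
    ((Complex.differentiableOn_dslope hU).2 hf).analyticAt hU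
  have hfk : f = fun w => f z + (w - z) * dslope f z w := by
    funext w
    have := sub_smul_dslope f z w
    rw [smul_eq_mul] at this
    rw [this]; ring
  have h1 : deriv f =ᶠ[𝓝 z] fun w => dslope f z w + (w - z) * deriv (dslope f z) w := by
    filter_upwards [hk.eventually_analyticAt] with w hw
    conv_lhs => rw [hfk]
    have := (((hasDerivAt_id' w).sub_const z).fun_mul hw.differentiableAt.hasDerivAt).const_add (f z)
    rw [HasDerivAt.deriv this, one_mul]
  rw [h1.deriv_eq]
  have h2 := hk.differentiableAt.hasDerivAt.fun_add
    (((hasDerivAt_id' z).sub_const z).fun_mul hk.deriv.differentiableAt.hasDerivAt)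
  rw [HasDerivAt.deriv h2]
  ring

/-- Bieberbach's theorem on the second coefficient of a univalent function in the disk. -/
theorem norm_deriv_deriv_le_four_mul {f : ℂ → ℂ} (hf : DifferentiableOn ℂ f (Metric.ball 0 1))
    (hinj : Set.InjOn f (Metric.ball 0 1)) :
    ‖deriv (deriv f) 0‖ ≤ 4 * ‖deriv f 0‖ := by
  have hB : Metric.ball (0 : ℂ) 1 ∈ 𝓝 0 := Metric.ball_mem_nhds 0 one_pos
  have h0B : (0 : ℂ) ∈ Metric.ball (0 : ℂ) 1 := Metric.mem_ball_self one_pos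
  have hf0 : deriv f 0 ≠ 0 := deriv_ne_zero_of_injOn Metric.isOpen_ball hf hinj h0B
  set k := dslope f 0 with hk
  have hkd : DifferentiableOn ℂ k (Metric.ball 0 1) := (Complex.differentiableOn_dslope hB).2 hf
  have hk0 : k 0 = deriv f 0 := dslope_same f 0
  have hfk : ∀ z, f z = f 0 + z * k z := by
    intro z
    have := sub_smul_dslope f 0 z
    rw [smul_eq_mul, sub_zero] at this
    rw [hk, this]; ring
  have hkne : ∀ z ∈ Metric.ball (0 : ℂ) 1, k z ≠ 0 := by
    intro z hz h
    have h1 : f z = f 0 := by rw [hfk z, h]; ring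
    have h2 := hinj hz h0B h1
    rw [h2, hk0] at h
    exact hf0 h
  have hsc : IsSimplyConnected (Metric.ball (0 : ℂ) 1) := by
    have := (convex_ball (0 : ℂ) 1).contractibleSpace ⟨0, h0B⟩
    exact (inferInstance : SimplyConnectedSpace (Metric.ball (0 : ℂ) 1))
  -- The function `p(z²)/z` has square `f'(0) / (f(z²) - f(0))`. Its coefficient of `z` is `p'(0) =
  -- -f''(0) / (4 f'(0))`, which the area theorem bounds by 1.
  obtain ⟨p, hpd, hp0, hp⟩ : ∃ p : ℂ → ℂ, DifferentiableOn ℂ p (Metric.ball 0 1) ∧ p 0 = 1 ∧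
      ∀ z, p z ^ 2 = k 0 * (k z)⁻¹ := by
    obtain ⟨s, hsd, hs⟩ := exists_holomorphic_sqrt Metric.isOpen_ball hsc
      (q := fun z => k 0 * (k z)⁻¹) ((hkd.inv hkne).const_mul _)
      (fun z hz => mul_ne_zero (hkne 0 h0B) (inv_ne_zero (hkne z hz)))
    have h1 := hs 0
    rw [mul_inv_cancel₀ (hkne 0 h0B), sq_eq_one_iff] at h1
    rcases h1 with h1 | h1
    · exact ⟨s, hsd, h1, hs⟩
    · exact ⟨fun z => -s z, hsd.neg, by simp [h1], fun z => by rw [neg_sq, hs]⟩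
  have hp' : deriv p 0 = - deriv k 0 / (2 * k 0) := by
    have h1 := (hpd.differentiableAt hB).hasDerivAt.fun_pow 2
    have h2 := ((hkd.differentiableAt hB).hasDerivAt.fun_inv (hkne 0 h0B)).const_mul (k 0)
    simp only [hp] at h1
    have h3 := h1.unique h2
    have h4 := hkne 0 h0B
    simp only [hp0] at h3
    norm_num at h3
    field_simp at h3 ⊢
    linear_combination h3
  set p₁ := dslope p 0 with hp₁
  have hp₁d : DifferentiableOn ℂ p₁ (Metric.ball 0 1) := (Complex.differentiableOn_dslope hB).2 hpd
  set p₂ := dslope p₁ 0 with hp₂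
  have hp₂d : DifferentiableOn ℂ p₂ (Metric.ball 0 1) :=
    (Complex.differentiableOn_dslope hB).2 hp₁d
  have hpexp : ∀ z, p z = 1 + deriv p 0 * z + z ^ 2 * p₂ z := by
    intro z
    have h1 := sub_smul_dslope p 0 z
    have h2 := sub_smul_dslope p₁ 0 z
    rw [smul_eq_mul, sub_zero] at h1 h2
    rw [← hp₁, hp0] at h1
    rw [← hp₂, hp₁, dslope_same, ← hp₁] at h2
    linear_combination -h1 - z * h2
  have hsq : Set.MapsTo (fun z : ℂ => z ^ 2) (Metric.ball 0 1) (Metric.ball 0 1) := by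
    intro z hz
    rw [mem_ball_zero_iff] at hz ⊢
    rw [norm_pow]
    exact pow_lt_one₀ (norm_nonneg z) hz two_ne_zero
  have hed : DifferentiableOn ℂ (fun z => z * p₂ (z ^ 2)) (Metric.ball 0 1) :=
    differentiableOn_id.mul (hp₂d.comp (by fun_prop) hsq)
  have hform : ∀ z : ℂ, z ≠ 0 → z⁻¹ + deriv p 0 * z + z ^ 2 * (z * p₂ (z ^ 2)) = p (z ^ 2) / z := by
    intro z hz
    rw [hpexp (z ^ 2)]
    field_simp
  have hle : ‖deriv p 0‖ ≤ 1 := by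
    refine norm_le_one_of_injOn_inv_add hed ?_
    rintro x ⟨hx, hx0⟩ y ⟨hy, hy0⟩ hxy
    rw [Set.mem_singleton_iff] at hx0 hy0
    simp only [hform x hx0, hform y hy0] at hxy
    have h1 : (p (x ^ 2) / x) ^ 2 = (p (y ^ 2) / y) ^ 2 := by rw [hxy]
    rw [div_pow, div_pow, hp, hp] at h1
    have hkx := hkne _ (hsq hx)
    have hky := hkne _ (hsq hy)
    have hk00 := hkne 0 h0B
    have h2 : x ^ 2 = y ^ 2 := by
      refine hinj (hsq hx) (hsq hy) ?_
      rw [hfk (x ^ 2), hfk (y ^ 2)]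
      simp only at hkx hky
      field_simp at h1
      linear_combination -h1
    -- The case `x = -y` is excluded because `p(z²)/z` is odd and has no zeros.
    rcases sq_eq_sq_iff_eq_or_eq_neg.1 h2 with h3 | h3
    · exact h3
    · exfalso
      rw [h2, h3] at hxy
      have h4 : p (y ^ 2) = 0 := by
        field_simp at hxy
        linear_combination -hxy / 2
      have h5 := hp (y ^ 2)
      rw [h4] at h5
      exact mul_ne_zero hk00 (inv_ne_zero hky) (by rw [← h5]; simp)
  have h2 : deriv (deriv f) 0 = 2 * deriv k 0 := deriv_deriv_eq_two_mul_deriv_dslope hB hf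
  rw [hp', norm_div, norm_neg, norm_mul, Complex.norm_ofNat, hk0,
    div_le_one (by positivity)] at hle
  rw [h2, norm_mul, Complex.norm_ofNat]
  linarith

/-! ### Harmonic mappings and the formula for the pre-Schwarzian derivative. -/

theorem harmonicOnNhd_of_eqOn_add_conj {f h g : ℂ → ℂ} {U : Set ℂ} (hU : IsOpen U)
    (hh : DifferentiableOn ℂ h U) (hg : DifferentiableOn ℂ g U)
    (hf : ∀ z ∈ U, f z = h z + conj (g z)) : InnerProductSpace.HarmonicOnNhd f U := by
  intro z hz
  have hUz := hU.mem_nhds hz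
  have h1 : InnerProductSpace.HarmonicAt h z := (hh.analyticAt hUz).harmonicAt
  have h2 : InnerProductSpace.HarmonicAt ((Complex.conjCLE : ℂ →L[ℝ] ℂ) ∘ g) z :=
    ((hg.analyticAt hUz).harmonicAt).comp_CLM _
  refine (InnerProductSpace.harmonicAt_congr_nhds ?_).2 (h1.add h2)
  filter_upwards [hUz] with w hw
  simp [hf w hw]

/-- A complex-valued harmonic function on a disk is the sum of a holomorphic and an
antiholomorphic function. -/
theorem exists_eqOn_add_conj_of_harmonicOnNhd_ball {f : ℂ → ℂ} {c : ℂ} {R : ℝ}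
    (hf : InnerProductSpace.HarmonicOnNhd f (Metric.ball c R)) :
    ∃ h g : ℂ → ℂ, DifferentiableOn ℂ h (Metric.ball c R) ∧
      DifferentiableOn ℂ g (Metric.ball c R) ∧ ∀ z ∈ Metric.ball c R, f z = h z + conj (g z) := by
  obtain ⟨p, hp, hpre⟩ := InnerProductSpace.HarmonicOnNhd.exists_analyticOnNhd_ball_re_eq
    (hf.comp_CLM Complex.reCLM)
  obtain ⟨q, hq, hqre⟩ := InnerProductSpace.HarmonicOnNhd.exists_analyticOnNhd_ball_re_eq
    (hf.comp_CLM Complex.imCLM)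
  have hp' := hp.differentiableOn
  have hq' := hq.differentiableOn
  -- With `Re f = Re p` and `Im f = Re q`, expand `f = (p + conj p)/2 + i (q + conj q)/2` and
  -- collect.
  refine ⟨fun z => (p z + Complex.I * q z) / 2, fun z => (p z - Complex.I * q z) / 2,
    by fun_prop, by fun_prop, fun z hz => ?_⟩
  have h1 : (p z).re = (f z).re := hpre hz
  have h2 : (q z).re = (f z).im := hqre hz
  rw [← Complex.re_add_im (f z), ← h1, ← h2, Complex.re_eq_add_conj, Complex.re_eq_add_conj,
    map_div₀, map_sub, map_mul, Complex.conj_I, map_ofNat]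
  ring

theorem hasFDerivAt_realLinearMap_of_eqOn {f h g : ℂ → ℂ} {U : Set ℂ} {z : ℂ} (hU : U ∈ 𝓝 z)
    (hh : DifferentiableOn ℂ h U) (hg : DifferentiableOn ℂ g U)
    (hf : ∀ z ∈ U, f z = h z + conj (g z)) :
    HasFDerivAt f (realLinearMap (deriv h z) (conj (deriv g z))) z :=
  (hasFDerivAt_add_conj (hh.differentiableAt hU).hasDerivAt
    (hg.differentiableAt hU).hasDerivAt).congr_of_eventuallyEq (Filter.eventually_of_mem hU hf)

theorem harmonicJacobian_of_eqOn {f h g : ℂ → ℂ} {U : Set ℂ} {z : ℂ} (hU : U ∈ 𝓝 z)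
    (hh : DifferentiableOn ℂ h U) (hg : DifferentiableOn ℂ g U)
    (hf : ∀ z ∈ U, f z = h z + conj (g z)) :
    harmonicJacobian f z = ‖deriv h z‖ ^ 2 - ‖deriv g z‖ ^ 2 := by
  rw [harmonicJacobian_of_hasFDerivAt (hasFDerivAt_realLinearMap_of_eqOn hU hh hg hf),
    RCLike.norm_conj]

/-- The derivative is written as `A v + conj (A v)`, so that `A` can be read off as the Wirtinger
derivative; this is already real, and `Complex.reCLM` only changes the codomain. -/
theorem hasFDerivAt_norm_sq {k : ℂ → ℂ} {k' z : ℂ} (hk : HasDerivAt k k' z) :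
    HasFDerivAt (fun w => ‖k w‖ ^ 2)
      (Complex.reCLM.comp (realLinearMap (k' * conj (k z)) (conj (k' * conj (k z))))) z := by
  have h1 := hk.hasFDerivAt_realLinearMap.norm_sq
  refine h1.congr_fderiv ?_
  ext v
  simp [Complex.inner]
  ring

theorem wirtingerDz_ofReal_log {J : ℂ → ℝ} {A z : ℂ}
    (hJ : HasFDerivAt J (Complex.reCLM.comp (realLinearMap A (conj A))) z) (h0 : J z ≠ 0) :
    wirtingerDz (fun w => ((Real.log (J w) : ℝ) : ℂ)) z = A / J z := by
  refine wirtingerDz_of_hasFDerivAt (b := conj A / J z) ?_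
  have h1 : HasFDerivAt (fun w => ((Real.log (J w) : ℝ) : ℂ)) (Complex.ofRealCLM.comp
      ((J z)⁻¹ • Complex.reCLM.comp (realLinearMap A (conj A)))) z :=
    Complex.ofRealCLM.hasFDerivAt.comp z (hJ.log h0)
  refine h1.congr_fderiv (ContinuousLinearMap.ext fun v => ?_)
  have h2 : (((A * v + conj A * conj v).re : ℝ) : ℂ) = A * v + conj A * conj v := by
    rw [← map_mul, Complex.add_conj]
    simp
  simp only [ContinuousLinearMap.comp_apply, smul_apply, realLinearMap_apply,
    Complex.reCLM_apply, Complex.ofRealCLM_apply, smul_eq_mul, Complex.ofReal_mul, h2,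
    Complex.ofReal_inv]
  ring

/-- The formula `P_f = (h'' conj h' - g'' conj g') / (|h'|² - |g'|²)` for `f = h + conj g`. -/
theorem harmonicPreSchwarzian_of_eqOn {f h g : ℂ → ℂ} {U : Set ℂ} {z : ℂ} (hU : IsOpen U)
    (hz : z ∈ U) (hh : DifferentiableOn ℂ h U) (hg : DifferentiableOn ℂ g U)
    (hf : ∀ z ∈ U, f z = h z + conj (g z)) (hJ : harmonicJacobian f z ≠ 0) :
    harmonicPreSchwarzian f z =
      (deriv (deriv h) z * conj (deriv h z) - deriv (deriv g) z * conj (deriv g z)) /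
        harmonicJacobian f z := by
  have hUz := hU.mem_nhds hz
  refine wirtingerDz_ofReal_log ?_ hJ
  have h1 := hasFDerivAt_norm_sq ((hh.deriv hU).differentiableAt hUz).hasDerivAt
  have h2 := hasFDerivAt_norm_sq ((hg.deriv hU).differentiableAt hUz).hasDerivAt
  have h3 : harmonicJacobian f =ᶠ[𝓝 z] fun w => ‖deriv h w‖ ^ 2 - ‖deriv g w‖ ^ 2 := by
    filter_upwards [hUz] with w hw
    exact harmonicJacobian_of_eqOn (hU.mem_nhds hw) hh hg hf
  refine ((h1.sub h2).congr_of_eventuallyEq h3).congr_fderiv ?_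
  ext v
  simp
  ring

/-! ### Affine normalization, conformal change of variable and conclusion. -/

/-- The bound for the pre-Schwarzian derivative at the centre of the disk by the specified order,
obtained by an affine normalization. -/
theorem norm_div_harmonicJacobian_le_specifiedOrder {F H G : ℂ → ℂ}
    (hF : IsUnivalentHarmonic F (Metric.ball 0 1)) (hdec : IsDiskDecomposition F H G) :
    ‖(deriv (deriv H) 0 * conj (deriv H 0) - deriv (deriv G) 0 * conj (deriv G 0)) /
      harmonicJacobian F 0‖ₑ ≤ 2 * specifiedOrder classSH := by
  obtain ⟨hH, hG, hFe⟩ := hdec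
  have hB : ∀ z ∈ Metric.ball (0 : ℂ) 1, Metric.ball (0 : ℂ) 1 ∈ 𝓝 z := fun z hz =>
    Metric.isOpen_ball.mem_nhds hz
  have h0B : (0 : ℂ) ∈ Metric.ball (0 : ℂ) 1 := Metric.mem_ball_self one_pos
  have hJ : ∀ z ∈ Metric.ball (0 : ℂ) 1, ‖deriv G z‖ ^ 2 < ‖deriv H z‖ ^ 2 := by
    intro z hz
    have := hF.sensePreserving z hz
    rw [harmonicJacobian_of_eqOn (hB z hz) hH hG hFe] at this
    linarith
  have hGH : ‖deriv G 0‖ < ‖deriv H 0‖ :=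
    lt_of_pow_lt_pow_left₀ 2 (norm_nonneg _) (hJ 0 h0B)
  have hH0 : deriv H 0 ≠ 0 := norm_pos_iff.1 ((norm_nonneg _).trans_lt hGH)
  -- The dilatation at `0`, of modulus below 1 since the Jacobian is positive. The map `w ↦ w - conj
  -- a * conj w` is then injective and cancels `g'(0)`; dividing by `d` makes `h'(0) = 1`.
  set a : ℂ := deriv G 0 / deriv H 0 with ha
  have ha1 : ‖a‖ < 1 := by
    rw [ha, norm_div, div_lt_one (norm_pos_iff.2 hH0)]
    exact hGH
  have haG : deriv G 0 = a * deriv H 0 := by rw [ha, div_mul_cancel₀ _ hH0]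
  set d : ℂ := deriv H 0 - conj a * deriv G 0 with hd
  have hd' : d = (1 - conj a * a) * deriv H 0 := by rw [hd, haG]; ring
  have hd0 : d ≠ 0 := by
    rw [hd']
    exact mul_ne_zero (diskAutomorphism.one_sub_conj_mul_self_ne_zero ha1) hH0
  have hdc : conj d ≠ 0 := by simpa using hd0
  set h : ℂ → ℂ := fun z => (H z - H 0 - conj a * (G z - G 0)) / d with hh
  set g : ℂ → ℂ := fun z => (G z - G 0 - a * (H z - H 0)) / conj d with hg
  set f : ℂ → ℂ := fun z => h z + conj (g z) with hf
  have hhd : DifferentiableOn ℂ h (Metric.ball 0 1) := by fun_prop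
  have hgd : DifferentiableOn ℂ g (Metric.ball 0 1) := by fun_prop
  have hh' : ∀ z ∈ Metric.ball (0 : ℂ) 1, deriv h z = (deriv H z - conj a * deriv G z) / d := by
    intro z hz
    exact ((((hH.differentiableAt (hB z hz)).hasDerivAt.sub_const _).sub
      (((hG.differentiableAt (hB z hz)).hasDerivAt.sub_const _).const_mul _)).div_const _).deriv
  have hg' : ∀ z ∈ Metric.ball (0 : ℂ) 1, deriv g z = (deriv G z - a * deriv H z) / conj d := by
    intro z hz
    exact ((((hG.differentiableAt (hB z hz)).hasDerivAt.sub_const _).sub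
      (((hH.differentiableAt (hB z hz)).hasDerivAt.sub_const _).const_mul _)).div_const _).deriv
  have hh'' : deriv (deriv h) 0 = (deriv (deriv H) 0 - conj a * deriv (deriv G) 0) / d := by
    rw [Filter.EventuallyEq.deriv_eq (Filter.eventually_of_mem (hB 0 h0B) hh')]
    exact ((((hH.deriv Metric.isOpen_ball).differentiableAt (hB 0 h0B)).hasDerivAt.sub
      (((hG.deriv Metric.isOpen_ball).differentiableAt
        (hB 0 h0B)).hasDerivAt.const_mul _)).div_const _).deriv
  have hfF : ∀ z ∈ Metric.ball (0 : ℂ) 1, f z = realLinearMap 1 (-conj a) (F z - F 0) / d := by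
    intro z hz
    simp only [hf, hh, hg, realLinearMap_apply, hFe z hz, hFe 0 h0B, map_add, map_sub, map_div₀,
      map_mul, Complex.conj_conj]
    field_simp
    ring
  have hdecf : IsDiskDecomposition f h g := ⟨hhd, hgd, fun _ _ => rfl⟩
  have hfclass : f ∈ classSH := by
    refine ⟨⟨harmonicOnNhd_of_eqOn_add_conj Metric.isOpen_ball hhd hgd fun _ _ => rfl, ?_, ?_⟩,
      h, g, hdecf, by simp [hh], ?_, by simp [hg]⟩
    · intro z hz
      rw [harmonicJacobian_of_eqOn (hB z hz) hhd hgd fun _ _ => rfl, hh' z hz, hg' z hz, norm_div,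
        norm_div, RCLike.norm_conj, div_pow, div_pow, ← sub_div]
      refine div_pos ?_ (by positivity)
      have hid : ‖deriv H z - conj a * deriv G z‖ ^ 2 - ‖deriv G z - a * deriv H z‖ ^ 2 =
          (1 - ‖a‖ ^ 2) * (‖deriv H z‖ ^ 2 - ‖deriv G z‖ ^ 2) := by
        simp only [Complex.sq_norm, Complex.normSq_apply, Complex.sub_re, Complex.sub_im,
          Complex.mul_re, Complex.mul_im, Complex.conj_re, Complex.conj_im]
        ring
      rw [hid]
      exact mul_pos (by nlinarith [norm_nonneg a]) (sub_pos.2 (hJ z hz))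
    · intro x hx y hy hxy
      rw [hfF x hx, hfF y hy, div_left_inj' hd0] at hxy
      have hinj := injective_realLinearMap_one (c := -conj a) (by simpa using ha1)
      exact hF.univalent hx hy (sub_left_injective (hinj hxy))
    · rw [hh' 0 h0B, ← hd, div_self hd0]
  -- Affine invariance at the centre: as `J_F(0) = d conj H'(0)`, the normalized `h''(0)` equals
  -- `P_F(0)`.
  have hval : deriv (deriv h) 0 =
      (deriv (deriv H) 0 * conj (deriv H 0) - deriv (deriv G) 0 * conj (deriv G 0)) /
        harmonicJacobian F 0 := by
    have hJ0 : (harmonicJacobian F 0 : ℂ) = d * conj (deriv H 0) := by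
      rw [harmonicJacobian_of_eqOn (hB 0 h0B) hH hG hFe]
      push_cast
      rw [← Complex.mul_conj', ← Complex.mul_conj', hd, haG]
      simp only [map_mul]
      ring
    have hHc : conj (deriv H 0) ≠ 0 := by simpa using hH0
    rw [hh'', hJ0, haG, map_mul]
    field_simp
  rw [← hval, specifiedOrder, ← mul_assoc, one_div,
    ENNReal.mul_inv_cancel two_ne_zero ENNReal.ofNat_ne_top, one_mul]
  refine le_sSup ⟨f, hfclass, h, g, hdecf, ?_, rfl⟩
  rw [hg' 0 h0B, haG, sub_self, zero_div]

/-- Harmonicity and the sign of the Jacobian are local, so decompositions of `f` on small disks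
suffice; the Jacobian is multiplied by `|φ'|² > 0`. -/
theorem IsUnivalentHarmonic.comp_isConformalOnto {f φ : ℂ → ℂ} {D : Set ℂ} (hD : IsOpen D)
    (hf : IsUnivalentHarmonic f D) (hφ : IsConformalOnto φ D) :
    IsUnivalentHarmonic (fun ζ => f (φ ζ)) (Metric.ball 0 1) := by
  have hloc : ∀ ζ ∈ Metric.ball (0 : ℂ) 1, ∃ (h g : ℂ → ℂ) (U V : Set ℂ), IsOpen U ∧ IsOpen V ∧
      ζ ∈ U ∧ φ ζ ∈ V ∧ DifferentiableOn ℂ φ U ∧ Set.MapsTo φ U V ∧ DifferentiableOn ℂ h V ∧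
      DifferentiableOn ℂ g V ∧ ∀ z ∈ V, f z = h z + conj (g z) := by
    intro ζ hζ
    obtain ⟨r, hr, hball⟩ := Metric.isOpen_iff.1 hD (φ ζ) (hφ.bijOn.mapsTo hζ)
    obtain ⟨h, g, hh, hg, hfe⟩ := exists_eqOn_add_conj_of_harmonicOnNhd_ball (hf.harmonic.mono hball)
    exact ⟨h, g, Metric.ball 0 1 ∩ φ ⁻¹' Metric.ball (φ ζ) r, Metric.ball (φ ζ) r,
      hφ.holomorphic.continuousOn.isOpen_inter_preimage Metric.isOpen_ball Metric.isOpen_ball,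
      Metric.isOpen_ball, ⟨hζ, Metric.mem_ball_self hr⟩, Metric.mem_ball_self hr,
      hφ.holomorphic.mono Set.inter_subset_left, fun _ h => h.2, hh, hg, hfe⟩
  refine ⟨fun ζ hζ => ?_, fun ζ hζ => ?_, hf.univalent.comp hφ.bijOn.injOn hφ.bijOn.mapsTo⟩
  · obtain ⟨h, g, U, V, hU, -, hζU, -, hφU, hUV, hh, hg, hfe⟩ := hloc ζ hζ
    exact harmonicOnNhd_of_eqOn_add_conj hU (hh.comp hφU hUV) (hg.comp hφU hUV)
      (fun z hz => hfe _ (hUV hz)) ζ hζU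
  · obtain ⟨h, g, U, V, hU, hV, hζU, hζV, hφU, hUV, hh, hg, hfe⟩ := hloc ζ hζ
    have hUζ := hU.mem_nhds hζU
    have hVζ := hV.mem_nhds hζV
    rw [harmonicJacobian_of_eqOn hUζ (hh.comp hφU hUV) (hg.comp hφU hUV)
      (fun z hz => hfe _ (hUV hz)), deriv_comp _ (hh.differentiableAt hVζ)
      (hφU.differentiableAt hUζ), deriv_comp _ (hg.differentiableAt hVζ)
      (hφU.differentiableAt hUζ), norm_mul, norm_mul, mul_pow, mul_pow, ← sub_mul]
    have h1 := hf.sensePreserving _ (hφ.bijOn.mapsTo hζ)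
    rw [harmonicJacobian_of_eqOn hVζ hh hg hfe] at h1
    exact mul_pos h1 (pow_pos (norm_pos_iff.2 (hφ.inverse_at hζ).1) 2)

/-- The transformation rule of the pre-Schwarzian derivative under a conformal change of the
independent variable. -/
theorem harmonicPreSchwarzian_comp_isConformalOnto {f φ : ℂ → ℂ} {D : Set ℂ} (hD : IsOpen D)
    (hf : IsUnivalentHarmonic f D) (hφ : IsConformalOnto φ D) {ζ : ℂ}
    (hζ : ζ ∈ Metric.ball (0 : ℂ) 1) :
    harmonicPreSchwarzian (fun ζ => f (φ ζ)) ζ =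
      harmonicPreSchwarzian f (φ ζ) * deriv φ ζ + deriv (deriv φ) ζ / deriv φ ζ := by
  obtain ⟨r, hr, hball⟩ := Metric.isOpen_iff.1 hD (φ ζ) (hφ.bijOn.mapsTo hζ)
  obtain ⟨h, g, hh, hg, hfe⟩ := exists_eqOn_add_conj_of_harmonicOnNhd_ball (hf.harmonic.mono hball)
  set V := Metric.ball (φ ζ) r with hV
  set U := Metric.ball 0 1 ∩ φ ⁻¹' V with hUdef
  have hU : IsOpen U :=
    hφ.holomorphic.continuousOn.isOpen_inter_preimage Metric.isOpen_ball Metric.isOpen_ball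
  have hζV : φ ζ ∈ V := Metric.mem_ball_self hr
  have hζU : ζ ∈ U := ⟨hζ, hζV⟩
  have hφU : DifferentiableOn ℂ φ U := hφ.holomorphic.mono Set.inter_subset_left
  have hUV : Set.MapsTo φ U V := fun _ h => h.2
  have hUζ := hU.mem_nhds hζU
  have hVζ : V ∈ 𝓝 (φ ζ) := Metric.isOpen_ball.mem_nhds hζV
  have hJF := (hf.comp_isConformalOnto hD hφ).sensePreserving ζ hζ
  have hJf := hf.sensePreserving _ (hφ.bijOn.mapsTo hζ)
  have hφ0 := (hφ.inverse_at hζ).1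
  have hφ0c : conj (deriv φ ζ) ≠ 0 := by simpa using hφ0
  have hc1 : ∀ k : ℂ → ℂ, DifferentiableOn ℂ k V → ∀ w ∈ U,
      deriv (k ∘ φ) w = deriv k (φ w) * deriv φ w := fun k hk w hw =>
    deriv_comp _ (hk.differentiableAt (Metric.isOpen_ball.mem_nhds (hUV hw)))
      (hφU.differentiableAt (hU.mem_nhds hw))
  have hc2 : ∀ k : ℂ → ℂ, DifferentiableOn ℂ k V → deriv (deriv (k ∘ φ)) ζ =
      deriv (deriv k) (φ ζ) * deriv φ ζ * deriv φ ζ + deriv k (φ ζ) * deriv (deriv φ) ζ := by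
    intro k hk
    rw [Filter.EventuallyEq.deriv_eq (Filter.eventually_of_mem hUζ (hc1 k hk))]
    exact ((((hk.deriv Metric.isOpen_ball).differentiableAt hVζ).hasDerivAt.comp ζ
      (hφU.differentiableAt hUζ).hasDerivAt).mul
      ((hφU.deriv hU).differentiableAt hUζ).hasDerivAt).deriv
  have hJrel : (harmonicJacobian (fun ζ => f (φ ζ)) ζ : ℂ) =
      harmonicJacobian f (φ ζ) * (deriv φ ζ * conj (deriv φ ζ)) := by
    rw [harmonicJacobian_of_eqOn hUζ (hh.comp hφU hUV) (hg.comp hφU hUV)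
      (fun z hz => hfe _ (hUV hz)), hc1 h hh ζ hζU, hc1 g hg ζ hζU,
      harmonicJacobian_of_eqOn hVζ hh hg hfe, Complex.mul_conj', norm_mul, norm_mul]
    push_cast
    ring
  have hJf' : (harmonicJacobian f (φ ζ) : ℂ) =
      deriv h (φ ζ) * conj (deriv h (φ ζ)) - deriv g (φ ζ) * conj (deriv g (φ ζ)) := by
    rw [harmonicJacobian_of_eqOn hVζ hh hg hfe, Complex.mul_conj', Complex.mul_conj']
    push_cast; rfl
  have hJne : (harmonicJacobian f (φ ζ) : ℂ) ≠ 0 := by exact_mod_cast hJf.ne'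
  rw [harmonicPreSchwarzian_of_eqOn hU hζU (hh.comp hφU hUV) (hg.comp hφU hUV)
    (fun z hz => hfe _ (hUV hz)) hJF.ne', hJrel, hc1 h hh ζ hζU, hc1 g hg ζ hζU, hc2 h hh, hc2 g hg,
    harmonicPreSchwarzian_of_eqOn Metric.isOpen_ball hζV hh hg hfe hJf.ne']
  rw [map_mul, map_mul]
  field_simp
  rw [hJf']
  ring

theorem theorem2 (D : Set ℂ) (hD_open : IsOpen D) (hD_sc : IsSimplyConnected D)
    (hD_ne : D ≠ Set.univ) (f : ℂ → ℂ) (hf : IsUnivalentHarmonic f D) (z : ℂ) (hz : z ∈ D) :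
    ENNReal.ofReal ((hyperbolicDensity D z)⁻¹ * ‖harmonicPreSchwarzian f z‖) ≤
      2 * (specifiedOrder classSH + 2) := by
  obtain ⟨φ, hφ, hφz⟩ := exists_isConformalOnto hD_open hD_sc hD_ne hz
  have h0 : (0 : ℂ) ∈ Metric.ball (0 : ℂ) 1 := Metric.mem_ball_self one_pos
  have hφ0 : deriv φ 0 ≠ 0 := (hφ.inverse_at h0).1
  have hF := hf.comp_isConformalOnto hD_open hφ
  obtain ⟨H, G, hH, hG, hFe⟩ := exists_eqOn_add_conj_of_harmonicOnNhd_ball hF.harmonic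
  have hbound := norm_div_harmonicJacobian_le_specifiedOrder hF ⟨hH, hG, hFe⟩
  rw [← harmonicPreSchwarzian_of_eqOn Metric.isOpen_ball h0 hH hG hFe
    (hF.sensePreserving 0 h0).ne'] at hbound
  have htrans := harmonicPreSchwarzian_comp_isConformalOnto hD_open hf hφ h0
  -- At the centre of the disk the relation defining the density reads `λ_D(z) |φ'(0)| = 1`.
  have hdens : (hyperbolicDensity D z)⁻¹ = ‖deriv φ 0‖ := by
    have := hyperbolicDensity_mul_norm_deriv hφ h0
    rw [hφz, norm_zero] at this
    exact inv_eq_of_mul_eq_one_right (this.trans (by norm_num))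
  have hbieb : ‖deriv (deriv φ) 0 / deriv φ 0‖ ≤ 4 := by
    rw [norm_div, div_le_iff₀ (norm_pos_iff.2 hφ0)]
    exact norm_deriv_deriv_le_four_mul hφ.holomorphic hφ.bijOn.injOn
  have hle : (hyperbolicDensity D z)⁻¹ * ‖harmonicPreSchwarzian f z‖ ≤
      ‖harmonicPreSchwarzian (fun ζ => f (φ ζ)) 0‖ + 4 := by
    rw [hdens, mul_comm, ← norm_mul, ← hφz, ← sub_eq_of_eq_add htrans]
    exact (norm_sub_le _ _).trans (by gcongr)
  -- The estimate is carried out in `[0, ∞]`, where the order takes its values; its finiteness is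
  -- not needed.
  calc ENNReal.ofReal ((hyperbolicDensity D z)⁻¹ * ‖harmonicPreSchwarzian f z‖)
      ≤ ENNReal.ofReal (‖harmonicPreSchwarzian (fun ζ => f (φ ζ)) 0‖ + 4) :=
        ENNReal.ofReal_le_ofReal hle
    _ = ‖harmonicPreSchwarzian (fun ζ => f (φ ζ)) 0‖ₑ + 4 := by
        rw [ENNReal.ofReal_add (norm_nonneg _) (by norm_num), ofReal_norm,
          ENNReal.ofReal_ofNat]
    _ ≤ 2 * specifiedOrder classSH + 4 := by gcongr
    _ = 2 * (specifiedOrder classSH + 2) := by rw [mul_add]; norm_num
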